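/- Let $n \ge 4$ and $c \in \mathbb{R}$, and let $\mathbb{R}^n(c)$ be the $n$-dimensional simply connected space form of constant sectional curvature $c$ (the round sphere if $c>0$, Euclidean space if $c=0$, hyperbolic space if $c<0$). Let $\Sigma$ be a connected bordered Riemann surface, i.e. a connected Hausdorff surface, possibly with boundary, with charts in the closed upper half plane whose coordinate changes are holomorphic in the interior and smooth up to the boundary. Let $u:\Sigma\to\mathbb{R}^n(c)$ be a branched immersion: a smooth (up to the boundary), weakly conformal map whose branch set $\mathcal{B}=\{p : du_p=0\}$ is discrete. Put $\Sigma_0:=\Sigma\setminus\mathcal{B}$. On $\Sigma_0$ let $H=\tfrac12\bigl(A(e_1,e_1)+A(e_2,e_2)\bigr)$ be the mean curvature vector, where $A$ is the second fundamental form of $u$ and $e_1,e_2$ is an orthonormal basis of the tangent plane $du(T_p\Sigma)$, let $\nabla^\perp$ be the normal connection and $R^\perp$ its curvature. Assume that on $\Sigma_0$ $$\nabla^\perp H\equiv 0,\qquad H\not\equiv 0,\qquad R^\perp\equiv 0 .$$ Then there is a $4$-dimensional embedded totally geodesic submanifold $P^4\subset\mathbb{R}^n(c)$, isometric to $\mathbb{R}^4(c)$,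 such that $u(\Sigma)\subset P^4$. -/

import Mathlib

open scoped Manifold ContDiff Topology

noncomputable section

/-! ### The space form of dimension `n` and constant curvature `c`

All three geometries are realised in `ℝ × ℝⁿ` with coordinates `x = (t, y)`:
the space form is `t² + c|y|² = 1` (the sheet `t > 0` if `c ≤ 0`), with the metric induced by
the flat form `⟨x, x'⟩_c = t t' / c + y · y'`.  For `c > 0` this is the round sphere of
radius `1/√c` and for `c < 0` the hyperboloid model `⟨x, x⟩_c = 1/c` in Minkowski space (the
coordinate `t` being rescaled by `√|c|`).  For `c = 0` it is the affine hyperplane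
`t = 1`, i.e. `ℝⁿ`; its tangent vectors are the `(0, z)` and the form is `y · y'`
(Lean's convention `0⁻¹ = 0` makes the first term vanish). -/

/-- The flat ambient vector space `ℝ × ℝⁿ`. -/
abbrev FlatAmbient (n : ℕ) : Type := ℝ × EuclideanSpace ℝ (Fin n)

/-- The flat bilinear form `⟨v, w⟩_c = v₀ w₀ / c + v' · w'`. -/
def ambForm {n : ℕ} (c : ℝ) (v w : FlatAmbient n) : ℝ :=
  c⁻¹ * (v.1 * w.1) + inner ℝ v.2 w.2

/-- The simply connected `n`-dimensional space form `ℝⁿ(c)` of curvature `c` (for `n ≥ 2`). -/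
def spaceForm (n : ℕ) (c : ℝ) : Set (FlatAmbient n) :=
  {x | x.1 ^ 2 + c * ‖x.2‖ ^ 2 = 1 ∧ (c ≤ 0 → 0 < x.1)}

/-- The differential at `x` (up to the factor `2`) of the defining function `t² + c|y|²`;
equal to `c ⟨x, v⟩_c` when `c ≠ 0`. -/
def conormalForm {n : ℕ} (c : ℝ) (x v : FlatAmbient n) : ℝ :=
  x.1 * v.1 + c * inner ℝ x.2 v.2

/-- `v` is tangent to the space form at its point `x`. -/
def IsTangentAt {n : ℕ} (c : ℝ) (x v : FlatAmbient n) : Prop :=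
  conormalForm c x v = 0

/-- Projection of ambient vectors at `x` to the tangent space of the space form along `ℝ x`.
For `c ≠ 0` it is the orthogonal projection.  For `c = 0` it fixes all vectors `(0, z)`, and only
those occur as derivatives of tangent fields. -/
def tangentProj {n : ℕ} (c : ℝ) (x v : FlatAmbient n) : FlatAmbient n :=
  v - conormalForm c x v • x

/-- A (complete, affinely parametrised, possibly constant) geodesic `ℝ → ℝⁿ(c)`: the
covariant acceleration, i.e. the tangential part of the flat acceleration, vanishes. -/
structure IsSpaceFormGeodesic (n : ℕ) (c : ℝ) (γ : ℝ → FlatAmbient n) : Prop where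
  smooth : ContDiff ℝ ∞ γ
  mem : ∀ t, γ t ∈ spaceForm n c
  accel : ∀ t, tangentProj c (γ t) (deriv (deriv γ) t) = 0

/-- `P` is an embedded totally geodesic submanifold of `ℝⁿ(c)` isometric to `ℝᵐ(c)`: it is the
image of an isometric embedding `F : ℝᵐ(c) → ℝⁿ(c)` that maps geodesics to geodesics.
(A map defined on the closed submanifold `ℝᵐ(c)` is smooth iff it is the restriction of a
smooth map of the ambient vector space.) -/
def IsTotallyGeodesicSpaceForm (m n : ℕ) (c : ℝ) (P : Set (FlatAmbient n)) : Prop :=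
  ∃ F : FlatAmbient m → FlatAmbient n,
    ContDiff ℝ ∞ F ∧
    Set.MapsTo F (spaceForm m c) (spaceForm n c) ∧
    Topology.IsEmbedding ((spaceForm m c).domRestrict F) ∧
    (∀ x ∈ spaceForm m c, ∀ v w, IsTangentAt c x v → IsTangentAt c x w →
      ambForm c (fderiv ℝ F x v) (fderiv ℝ F x w) = ambForm c v w) ∧
    (∀ γ, IsSpaceFormGeodesic m c γ → IsSpaceFormGeodesic n c (F ∘ γ)) ∧
    F '' spaceForm m c = P

/-! ### Bordered Riemann surfaces -/

/-- The closed upper half plane. -/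
abbrev ClosedHalfPlane : Type := {z : ℂ // 0 ≤ z.im}

theorem range_closedHalfPlane_val :
    Set.range (Subtype.val : ClosedHalfPlane → ℂ) = {z : ℂ | 0 ≤ z.im} :=
  Subtype.range_coe

/-- The closed upper half plane as a *complex* model with boundary.  A bordered Riemann surface is
a space charted on it with `IsManifold halfPlaneModel ∞`: coordinate changes are complex
differentiable, holomorphic in the interior and smooth up to the boundary. -/
def halfPlaneModel : ModelWithCorners ℂ ℂ ClosedHalfPlane where
  toFun := Subtype.val
  invFun z := ⟨⟨z.re, max z.im 0⟩, le_max_right _ _⟩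
  source := Set.univ
  target := {z | 0 ≤ z.im}
  map_source' z _ := z.property
  map_target' _ _ := Set.mem_univ _
  left_inv' := fun ⟨z, hz⟩ _ => by
    apply Subtype.ext
    apply Complex.ext
    · rfl
    · exact max_eq_left hz
  right_inv' z hz := by
    apply Complex.ext
    · rfl
    · exact max_eq_left hz
  source_eq := rfl
  convex_range' := by
    simp only [instIsRCLikeNormedField, ↓reduceDIte]
    apply Convex.convex_isRCLikeNormedField
    change Convex ℝ (Set.range (Subtype.val : ClosedHalfPlane → ℂ))
    rw [range_closedHalfPlane_val]
    exact convex_halfSpace_im_ge 0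
  nonempty_interior' := by
    change (interior (Set.range (Subtype.val : ClosedHalfPlane → ℂ))).Nonempty
    rw [range_closedHalfPlane_val]
    refine ⟨Complex.I, mem_interior.2 ⟨{z | 0 < z.im}, fun z hz => le_of_lt (a := (0 : ℝ)) (b := z.im) hz, ?_, ?_⟩⟩
    · exact isOpen_lt continuous_const Complex.continuous_im
    · simp
  continuous_toFun := continuous_subtype_val
  continuous_invFun := by
    refine Continuous.subtype_mk ?_ _
    exact Complex.equivRealProdCLM.symm.continuous.comp
      (Complex.continuous_re.prodMk (Complex.continuous_im.max continuous_const))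

section Surface

variable {S : Type*} [TopologicalSpace S]

/-- The derivative of `g` at `p` along the constant coordinate field `v ∈ ℂ = ℝ²` of the complex
coordinate `e` (so `v = 1` and `v = i` give `∂g/∂x¹` and `∂g/∂x²`). -/
def coordDeriv {F : Type*} [NormedAddCommGroup F] [NormedSpace ℝ F]
    (e : OpenPartialHomeomorph S ClosedHalfPlane) (g : S → F) (v : ℂ) (p : S) : F :=
  fderivWithin ℝ (g ∘ (e.extend halfPlaneModel).symm) {z : ℂ | 0 ≤ z.im}
    (e.extend halfPlaneModel p) v

/-- `g` is (real) smooth, up to the boundary, on the open subset `U` of the surface. -/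
def SmoothOnSurface [ChartedSpace ClosedHalfPlane S] {F : Type*} [NormedAddCommGroup F]
    [NormedSpace ℝ F] (g : S → F) (U : Set S) : Prop :=
  ∀ e ∈ atlas ClosedHalfPlane S,
    ContDiffOn ℝ ∞ (g ∘ (e.extend halfPlaneModel).symm)
      ((e.extend halfPlaneModel).target ∩ (e.extend halfPlaneModel).symm ⁻¹' U)

variable {n : ℕ}

/-- The branch points of `u`: the points where `du = 0`. -/
def branchSet [ChartedSpace ClosedHalfPlane S] (u : S → FlatAmbient n) : Set S :=
  {p | ∀ v : ℂ, coordDeriv (chartAt ClosedHalfPlane p) u v p = 0}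

/-- `u` is a branched immersion into `ℝⁿ(c)`: smooth, weakly conformal, and immersed
except on a discrete set.  (By weak conformality `du` is injective where it does not vanish.) -/
structure IsBranchedImmersion [ChartedSpace ClosedHalfPlane S] (c : ℝ) (u : S → FlatAmbient n) :
    Prop where
  mem : ∀ p, u p ∈ spaceForm n c
  smooth : SmoothOnSurface u Set.univ
  conformal_norm : ∀ e ∈ atlas ClosedHalfPlane S, ∀ p ∈ e.source,
    ambForm c (coordDeriv e u 1 p) (coordDeriv e u 1 p) =
      ambForm c (coordDeriv e u Complex.I p) (coordDeriv e u Complex.I p)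
  conformal_orthogonal : ∀ e ∈ atlas ClosedHalfPlane S, ∀ p ∈ e.source,
    ambForm c (coordDeriv e u 1 p) (coordDeriv e u Complex.I p) = 0
  discrete_branchSet : IsDiscrete (branchSet u)

/-! In the following definitions `e` is a complex coordinate of the surface and `u` is weakly
conformal, so that off the branch points the coordinate fields
`∂₁u`, `∂₂u` form an orthogonal basis of the tangent plane `du(T_pS)`. -/

/-- The Levi-Civita connection of `ℝⁿ(c)` along `u`, applied to a field `ξ` of vectors tangent to
`ℝⁿ(c)` along `u`: the tangential part of the flat derivative. -/
def ambientCovDeriv (c : ℝ) (u : S → FlatAmbient n)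
    (e : OpenPartialHomeomorph S ClosedHalfPlane) (v : ℂ) (ξ : S → FlatAmbient n) (p : S) :
    FlatAmbient n :=
  tangentProj c (u p) (coordDeriv e ξ v p)

/-- The component `X^⊥` of `X ∈ T_{u(p)}ℝⁿ(c)` orthogonal to `du(T_pS)`, for `p` not a branch
point. -/
def normalPart (c : ℝ) (u : S → FlatAmbient n)
    (e : OpenPartialHomeomorph S ClosedHalfPlane) (p : S) (X : FlatAmbient n) : FlatAmbient n :=
  X - (ambForm c X (coordDeriv e u 1 p) /
        ambForm c (coordDeriv e u 1 p) (coordDeriv e u 1 p)) • coordDeriv e u 1 p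
    - (ambForm c X (coordDeriv e u Complex.I p) /
        ambForm c (coordDeriv e u Complex.I p) (coordDeriv e u Complex.I p)) •
          coordDeriv e u Complex.I p

/-- The normal connection `∇^⊥_v ξ`. -/
def normalCovDeriv (c : ℝ) (u : S → FlatAmbient n)
    (e : OpenPartialHomeomorph S ClosedHalfPlane) (v : ℂ) (ξ : S → FlatAmbient n) (p : S) :
    FlatAmbient n :=
  normalPart c u e p (ambientCovDeriv c u e v ξ p)

/-- The second fundamental form `A(∂_v u, ∂_w u) = (∇_v ∂_w u)^⊥`. -/
def secondFundForm (c : ℝ) (u : S → FlatAmbient n)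
    (e : OpenPartialHomeomorph S ClosedHalfPlane) (v w : ℂ) (p : S) : FlatAmbient n :=
  normalPart c u e p (ambientCovDeriv c u e v (coordDeriv e u w) p)

/-- The mean curvature vector `H = (A(e₁,e₁) + A(e₂,e₂)) / 2` for the orthonormal basis
`eᵢ = ∂ᵢu / |∂ᵢu|` of `du(T_pS)`.  It does not depend on the complex coordinate `e`. -/
def meanCurvature (c : ℝ) (u : S → FlatAmbient n)
    (e : OpenPartialHomeomorph S ClosedHalfPlane) (p : S) : FlatAmbient n :=
  (1 / 2 : ℝ) •
    ((ambForm c (coordDeriv e u 1 p) (coordDeriv e u 1 p))⁻¹ • secondFundForm c u e 1 1 p +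
     (ambForm c (coordDeriv e u Complex.I p) (coordDeriv e u Complex.I p))⁻¹ •
        secondFundForm c u e Complex.I Complex.I p)

/-- `∇^⊥ H = 0` off the branch points. -/
def HasParallelMeanCurvature [ChartedSpace ClosedHalfPlane S] (c : ℝ) (u : S → FlatAmbient n) :
    Prop :=
  ∀ e ∈ atlas ClosedHalfPlane S, ∀ p ∈ e.source, p ∉ branchSet u → ∀ v : ℂ,
    normalCovDeriv c u e v (meanCurvature c u e) p = 0

/-- `H` vanishes identically off the branch points. -/
def MeanCurvatureVanishes [ChartedSpace ClosedHalfPlane S] (c : ℝ) (u : S → FlatAmbient n) :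
    Prop :=
  ∀ e ∈ atlas ClosedHalfPlane S, ∀ p ∈ e.source, p ∉ branchSet u → meanCurvature c u e p = 0

/-- `ξ` is a smooth section of the normal bundle of `u` over `U`, where `U` is an open subset
of the domain of the coordinate `e` without branch points. -/
structure IsNormalSection [ChartedSpace ClosedHalfPlane S] (c : ℝ) (u : S → FlatAmbient n)
    (e : OpenPartialHomeomorph S ClosedHalfPlane) (U : Set S) (ξ : S → FlatAmbient n) :
    Prop where
  smooth : SmoothOnSurface ξ U
  tangent : ∀ p ∈ U, IsTangentAt c (u p) (ξ p)
  normal : ∀ p ∈ U, ∀ v : ℂ, ambForm c (ξ p) (coordDeriv e u v p) = 0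

/-- The normal curvature `R^⊥(X, Y) ξ = ∇^⊥_X ∇^⊥_Y ξ - ∇^⊥_Y ∇^⊥_X ξ - ∇^⊥_{[X,Y]} ξ` for the
constant coordinate fields `X = v`, `Y = w`, for which `[X, Y] = 0`. -/
def normalCurvature (c : ℝ) (u : S → FlatAmbient n)
    (e : OpenPartialHomeomorph S ClosedHalfPlane) (v w : ℂ) (ξ : S → FlatAmbient n) (p : S) :
    FlatAmbient n :=
  normalCovDeriv c u e v (normalCovDeriv c u e w ξ) p -
    normalCovDeriv c u e w (normalCovDeriv c u e v ξ) p

/-- `R^⊥ = 0` off the branch points. -/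
def HasFlatNormalBundle [ChartedSpace ClosedHalfPlane S] (c : ℝ) (u : S → FlatAmbient n) :
    Prop :=
  ∀ e ∈ atlas ClosedHalfPlane S, ∀ U : Set S, IsOpen U → U ⊆ e.source \ branchSet u →
    ∀ ξ : S → FlatAmbient n, IsNormalSection c u e U ξ →
      ∀ p ∈ U, ∀ v w : ℂ, normalCurvature c u e v w ξ p = 0

end Surface

end

/-!
Let `φ = α - iγ` be the normal-valued Hopf differential `4 A(∂_z, ∂_z)` in a complex coordinate.
If `∇^⊥ H = 0`, the Codazzi equation says that `φ` is holomorphic for the normal connection, and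
by the Ricci equation `R^⊥ = 0` means that `α` and `γ` are proportional.  The quartic differential
`⟨φ, φ⟩` is then holomorphic and vanishes only where `φ` does, so `φ` is identically zero or has
countably many zeros.  Off these zeros the six fields `u, ∂₁u, ∂₂u, H, α, γ` have all their first
derivatives in their own span, which has dimension at most five because `α` and `γ` are
proportional; by uniqueness for linear systems it is a fixed linear subspace containing `u`.  The
same system gives unique continuation: a connected patch of which an open part lies in a linear
subspace lies in it.  Removing countably many points does not disconnect a patch, so the whole
surface lies in a linear subspace of dimension at most five, and such a subspace meets the space
form inside a totally geodesic `ℝ⁴(c)`.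
-/

/-! ### Connectedness and countable sets -/

section Connectedness

variable {X : Type*} [TopologicalSpace X]

theorem isPreconnected_of_locally_of_subset_closure {s t : Set X} (ht : IsPreconnected t)
    (hst : s ⊆ t) (hts : t ⊆ closure s) (hloc : ∀ x ∈ t, ∃ N ∈ 𝓝 x, IsPreconnected (s ∩ N)) :
    IsPreconnected s := by
  rw [isPreconnected_iff_subset_of_disjoint] at ht ⊢
  intro U V hU hV hcover hdisj
  have h := ht {x | ∀ᶠ y in 𝓝 x, y ∈ s → y ∈ U} {x | ∀ᶠ y in 𝓝 x, y ∈ s → y ∈ V}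
    isOpen_setOfPred_eventually_nhds isOpen_setOfPred_eventually_nhds ?_ ?_
  · exact h.imp (fun h x hx => (h (hst hx)).self_of_nhds hx)
      fun h x hx => (h (hst hx)).self_of_nhds hx
  · intro x hx
    obtain ⟨N, hN, hconn⟩ := hloc x hx
    rw [isPreconnected_iff_subset_of_disjoint] at hconn
    refine (hconn U V hU hV (Set.inter_subset_left.trans hcover) ?_).imp ?_ ?_
    · rw [Set.inter_right_comm, hdisj, Set.empty_inter]
    all_goals exact fun h => Filter.mem_of_superset hN fun y hyN hys => h ⟨hys, hyN⟩
  · refine Set.eq_empty_of_forall_notMem ?_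
    rintro x ⟨hx, hxU, hxV⟩
    obtain ⟨y, hys, hyU, hyV⟩ :=
      ((mem_closure_iff_frequently.1 (hts hx)).and_eventually (hxU.and hxV)).exists
    exact Set.notMem_empty y (hdisj ▸ ⟨hys, hyU hys, hyV hys⟩)

theorem eq_univ_of_isClosed_of_subset_of_inter_interior_nonempty [PreconnectedSpace X] {s : Set X}
    (hs : IsClosed s) (hne : (interior s).Nonempty)
    (hloc : ∀ x, ∃ A, closure A ∈ 𝓝 x ∧ ((A ∩ interior s).Nonempty → A ⊆ s)) : s = Set.univ := by
  have hclosed : IsClosed (interior s) := by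
    refine isClosed_of_closure_subset fun x hx => ?_
    obtain ⟨A, hA, hAs⟩ := hloc x
    obtain ⟨y, hyA, hys⟩ := mem_closure_iff_nhds.1 hx _ hA
    have hAs := hAs (Set.inter_comm _ A ▸ mem_closure_iff.1 hyA _ isOpen_interior hys)
    exact mem_interior_iff_mem_nhds.2 (Filter.mem_of_superset hA (hs.closure_subset_iff.2 hAs))
  exact Set.eq_univ_of_univ_subset
    ((IsClopen.eq_univ ⟨hclosed, isOpen_interior⟩ hne).symm.subset.trans interior_subset)

end Connectedness

section RemoveCountable

variable {E : Type*} [NormedAddCommGroup E] [NormedSpace ℝ E]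

theorem isPreconnected_ball_diff_countable (hE : 1 < Module.rank ℝ E) (x : E) {r : ℝ} (hr : 0 < r)
    {C : Set E} (hC : C.Countable) : IsPreconnected (Metric.ball x r \ C) := by
  let e := OpenPartialHomeomorph.univBall x r
  have hsource : e.source = Set.univ := OpenPartialHomeomorph.univBall_source x r
  have hinj : Function.Injective e := Set.injOn_univ.1 (hsource ▸ e.injOn)
  have hcont : Continuous e := continuousOn_univ.1 (hsource ▸ e.continuousOn)
  have himage : Metric.ball x r \ C = e '' (e ⁻¹' C)ᶜ := by
    rw [← Set.preimage_compl, Set.image_preimage_eq_inter_range, ← Set.image_univ, ← hsource,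
      e.image_source_eq_target, OpenPartialHomeomorph.univBall_target x hr, Set.inter_comm,
      Set.sdiff_eq]
  rw [himage]
  exact ((hC.preimage hinj).isConnected_compl_of_one_lt_rank hE).isPreconnected.image _
    hcont.continuousOn

theorem isPreconnected_diff_countable (hE : 1 < Module.rank ℝ E) {Ω C : Set E} (hop : IsOpen Ω)
    (hΩ : IsPreconnected Ω) (hC : C.Countable) : IsPreconnected (Ω \ C) := by
  have : Nontrivial E := (rank_pos_iff_nontrivial (R := ℝ)).1 (zero_lt_one.trans hE)
  refine isPreconnected_of_locally_of_subset_closure hΩ Set.sdiff_subset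
    ((hC.dense_compl ℝ).open_subset_closure_inter hop) fun x hx => ?_
  obtain ⟨r, hr, hball⟩ := Metric.isOpen_iff.1 hop x hx
  refine ⟨_, Metric.ball_mem_nhds x hr, ?_⟩
  have := isPreconnected_ball_diff_countable hE x hr hC
  rwa [Set.sdiff_inter_right_comm, Set.inter_eq_self_of_subset_right hball]

end RemoveCountable

theorem countable_zeros_of_differentiableOn {Ω : Set ℂ} (hop : IsOpen Ω) (hΩ : IsPreconnected Ω)
    {f : ℂ → ℂ} (hf : DifferentiableOn ℂ f Ω) (hne : ¬ Set.EqOn f 0 Ω) :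
    (Ω ∩ f ⁻¹' {0}).Countable := by
  have hev := ((hf.analyticOnNhd hop).eqOn_zero_or_eventually_ne_zero_of_preconnected
    hΩ).resolve_left hne
  rw [Set.inter_comm]
  exact IsLindelof.countable_of_isDiscrete (HereditarilyLindelofSpace.isLindelof _)
    (isDiscrete_of_codiscreteWithin (s := f ⁻¹' {0}) hev)

/-! ### Linear first-order systems -/

section LinearODE

variable {E : Type*} [NormedAddCommGroup E] [NormedSpace ℝ E]

theorem eq_zero_of_linear_ode {A : ℝ → E →L[ℝ] E} {y : ℝ → E} {a b : ℝ}
    (hA : ContinuousOn A (Set.Icc a b)) (hy : ∀ t ∈ Set.Icc a b, HasDerivAt y (A t (y t)) t)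
    (ha : y a = 0) : ∀ t ∈ Set.Icc a b, y t = 0 := by
  obtain ⟨K, hK⟩ := isCompact_Icc.exists_bound_of_continuousOn hA
  exact eq_zero_of_abs_deriv_le_mul_abs_self_of_eq_zero_right
    (fun t ht => (hy t ht).continuousAt.continuousWithinAt)
    (fun t ht => (hy t (Set.Ico_subset_Icc_self ht)).hasDerivWithinAt) ha
    fun t ht => (A t).le_of_opNorm_le (hK t (Set.Ico_subset_Icc_self ht)) _

theorem eq_zero_of_linear_ode_pi {ι : Type*} [Fintype ι] {m : ι → ι → ℝ → ℝ} {y : ι → ℝ → E}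
    {a b : ℝ} (hm : ∀ i j, ContinuousOn (m i j) (Set.Icc a b))
    (hy : ∀ i, ∀ t ∈ Set.Icc a b, HasDerivAt (y i) (∑ j, m i j t • y j t) t)
    (ha : ∀ i, y i a = 0) : ∀ t ∈ Set.Icc a b, ∀ i, y i t = 0 := by
  classical
  let A (t : ℝ) : (ι → E) →L[ℝ] (ι → E) :=
    ∑ i, ∑ j, m i j t • (ContinuousLinearMap.single ℝ (fun _ => E) i).comp
      (ContinuousLinearMap.proj (R := ℝ) (φ := fun _ : ι => E) j)
  have hA : ContinuousOn A (Set.Icc a b) :=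
    continuousOn_finsetSum _ fun i _ => continuousOn_finsetSum _ fun j _ =>
      (hm i j).smul continuousOn_const
  have hAy (t : ℝ) (Y : ι → E) : A t Y = fun i => ∑ j, m i j t • Y j := by
    ext i
    simp [A, Pi.single_apply]
  have hzero := eq_zero_of_linear_ode (y := fun t i => y i t) hA
    (fun t ht => by rw [hAy, hasDerivAt_pi]; exact fun i => hy i t ht) (funext ha)
  exact fun t ht i => congrFun (hzero t ht) i

end LinearODE

section ContSpan

variable {ι V E : Type*} [Fintype ι] [TopologicalSpace V] [AddCommGroup E] [Module ℝ E]

/-- `f` is a combination of the fields `X j` with coefficients continuous on `Ω`. -/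
def ContSpan (X : ι → V → E) (Ω : Set V) (f : V → E) : Prop :=
  ∃ m : ι → V → ℝ, (∀ j, ContinuousOn (m j) Ω) ∧ ∀ z ∈ Ω, f z = ∑ j, m j z • X j z

namespace ContSpan

variable {X : ι → V → E} {Ω : Set V} {f g : V → E}

theorem add (hf : ContSpan X Ω f) (hg : ContSpan X Ω g) :
    ContSpan X Ω (fun z => f z + g z) := by
  obtain ⟨m, hm, hf⟩ := hf
  obtain ⟨k, hk, hg⟩ := hg
  refine ⟨fun j z => m j z + k j z, fun j => (hm j).add (hk j), fun z hz => ?_⟩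
  simp only [hf z hz, hg z hz, add_smul, Finset.sum_add_distrib]

theorem smul {a : V → ℝ} (ha : ContinuousOn a Ω) (hf : ContSpan X Ω f) :
    ContSpan X Ω (fun z => a z • f z) := by
  obtain ⟨m, hm, hf⟩ := hf
  refine ⟨fun j z => a z * m j z, fun j => ha.mul (hm j), fun z hz => ?_⟩
  simp only [hf z hz, Finset.smul_sum, mul_smul]

theorem congr (hf : ContSpan X Ω f) (h : ∀ z ∈ Ω, g z = f z) : ContSpan X Ω g := by
  obtain ⟨m, hm, hf⟩ := hf
  exact ⟨m, hm, fun z hz => (h z hz).trans (hf z hz)⟩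

theorem zero : ContSpan X Ω (fun _ => 0) :=
  ⟨fun _ _ => 0, fun _ => continuousOn_const, fun z _ => by simp⟩

theorem single (j : ι) : ContSpan X Ω (X j) := by
  classical
  refine ⟨fun i _ => if i = j then 1 else 0, fun _ => continuousOn_const, fun z _ => ?_⟩
  simp

end ContSpan

end ContSpan

section SolvesLinearSystem

variable {ι V E : Type*} [Fintype ι] [NormedAddCommGroup V] [NormedSpace ℝ V]
  [NormedAddCommGroup E] [NormedSpace ℝ E]

/-- On `Ω` the fields `X i` solve a linear first-order system in closed form: all their
directional derivatives are combinations of the `X j` with continuous coefficients. -/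
structure SolvesLinearSystem (X : ι → V → E) (Ω : Set V) : Prop where
  differentiableOn : ∀ i, DifferentiableOn ℝ (X i) Ω
  contSpan_fderiv : ∀ i v, ContSpan X Ω (fun z => fderiv ℝ (X i) z v)

namespace SolvesLinearSystem

variable {X : ι → V → E} {Ω : Set V} {W : Submodule ℝ E} {z₀ z : V}

theorem mem_submodule_of_segment_subset (hX : SolvesLinearSystem X Ω) (hop : IsOpen Ω)
    (hW : IsClosed (W : Set E)) (hseg : segment ℝ z₀ z ⊆ Ω) (h0 : ∀ i, X i z₀ ∈ W) (i : ι) :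
    X i z ∈ W := by
  choose m hm hmX using fun i => hX.contSpan_fderiv i (z - z₀)
  let c := AffineMap.lineMap (k := ℝ) z₀ z
  have hc : Set.MapsTo c (Set.Icc 0 1) Ω := fun t ht =>
    hseg (segment_eq_image_lineMap ℝ z₀ z ▸ Set.mem_image_of_mem _ ht)
  have hderiv (i : ι) (t : ℝ) (ht : t ∈ Set.Icc (0 : ℝ) 1) :
      HasDerivAt (fun t => W.mkQL (X i (c t))) (∑ j, m i j (c t) • W.mkQL (X j (c t))) t := by
    have hXi := ((hX.differentiableOn i).differentiableAt (hop.mem_nhds (hc ht))).hasFDerivAt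
    have h := W.mkQL.hasFDerivAt.comp_hasDerivAt t
      (hXi.comp_hasDerivAt t (AffineMap.hasDerivAt_lineMap (a := z₀) (b := z)))
    exact h.congr_deriv
      ((congrArg W.mkQL (hmX i _ (hc ht))).trans (by simp only [map_sum, map_smul]))
  have hzero := eq_zero_of_linear_ode_pi
    (fun i j => (hm i j).comp (AffineMap.lineMap_continuous.continuousOn) hc) hderiv
    (fun i => by simpa [c] using h0 i) 1 (by simp) i
  simpa [c] using hzero

theorem mem_submodule (hX : SolvesLinearSystem X Ω) (hop : IsOpen Ω) (hΩ : IsPreconnected Ω)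
    (hW : IsClosed (W : Set E)) (hz₀ : z₀ ∈ Ω) (h0 : ∀ i, X i z₀ ∈ W) (hz : z ∈ Ω) (i : ι) :
    X i z ∈ W := by
  have hlocal {z : V} (hz : z ∈ Ω) (h : ∀ i, X i z ∈ W) : ∀ᶠ w in 𝓝 z, ∀ i, X i w ∈ W := by
    obtain ⟨r, hr, hball⟩ := Metric.isOpen_iff.1 hop z hz
    filter_upwards [Metric.ball_mem_nhds z hr] with w hw
    exact hX.mem_submodule_of_segment_subset hop hW
      (((convex_ball z r).segment_subset (Metric.mem_ball_self hr) hw).trans hball) h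
  have hsub : Ω ⊆ {z | ∀ᶠ w in 𝓝 z, ∀ i, X i w ∈ W} := by
    refine hΩ.subset_of_closure_inter_subset isOpen_setOfPred_eventually_nhds
      ⟨z₀, hz₀, hlocal hz₀ h0⟩ ?_
    rintro z ⟨hzc, hz⟩
    refine hlocal hz fun i => hW.closure_subset ?_
    exact ((hX.differentiableOn i).continuousOn.continuousAt
      (hop.mem_nhds hz)).continuousWithinAt.mem_closure hzc fun w hw => hw.self_of_nhds i
  exact (hsub hz).self_of_nhds i

end SolvesLinearSystem

end SolvesLinearSystem

/-! ### The flat form and the conormal form -/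

section Forms

variable {n : ℕ} {c : ℝ}

/-- The bilinear form `a v₀ w₀ + b v' · w'` on `ℝ × ℝⁿ`, the common shape of the flat form and of
the conormal form. -/
noncomputable def diagForm (n : ℕ) (a b : ℝ) : FlatAmbient n →L[ℝ] FlatAmbient n →L[ℝ] ℝ :=
  a • (ContinuousLinearMap.mul ℝ ℝ).bilinearComp
      (ContinuousLinearMap.fst ℝ ℝ _) (ContinuousLinearMap.fst ℝ ℝ _) +
    b • (innerSL ℝ).bilinearComp
      (ContinuousLinearMap.snd ℝ ℝ _) (ContinuousLinearMap.snd ℝ ℝ _)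

theorem ambForm_eq_diagForm (v w : FlatAmbient n) : ambForm c v w = diagForm n c⁻¹ 1 v w := by
  simp [ambForm, diagForm]

theorem conormalForm_eq_diagForm (v w : FlatAmbient n) :
    conormalForm c v w = diagForm n 1 c v w := by
  simp [conormalForm, diagForm]

theorem ambForm_comm (v w : FlatAmbient n) : ambForm c v w = ambForm c w v := by
  simp only [ambForm, mul_comm v.1, real_inner_comm]

theorem ambForm_add_left (v v' w : FlatAmbient n) :
    ambForm c (v + v') w = ambForm c v w + ambForm c v' w := by
  simp only [ambForm_eq_diagForm, map_add, add_apply]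

theorem ambForm_sub_left (v v' w : FlatAmbient n) :
    ambForm c (v - v') w = ambForm c v w - ambForm c v' w := by
  simp only [ambForm_eq_diagForm, map_sub, sub_apply]

theorem ambForm_smul_left (a : ℝ) (v w : FlatAmbient n) :
    ambForm c (a • v) w = a * ambForm c v w := by
  simp only [ambForm_eq_diagForm, map_smul, smul_apply, smul_eq_mul]

theorem ambForm_add_right (v w w' : FlatAmbient n) :
    ambForm c v (w + w') = ambForm c v w + ambForm c v w' := by
  simp only [ambForm_eq_diagForm, map_add]

theorem ambForm_sub_right (v w w' : FlatAmbient n) :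
    ambForm c v (w - w') = ambForm c v w - ambForm c v w' := by
  simp only [ambForm_eq_diagForm, map_sub]

theorem ambForm_smul_right (a : ℝ) (v w : FlatAmbient n) :
    ambForm c v (a • w) = a * ambForm c v w := by
  simp only [ambForm_eq_diagForm, map_smul, smul_eq_mul]

theorem ambForm_neg_right (v w : FlatAmbient n) : ambForm c v (-w) = -ambForm c v w := by
  rw [ambForm_eq_diagForm, ambForm_eq_diagForm, map_neg]

theorem ambForm_zero_right (v : FlatAmbient n) : ambForm c v 0 = 0 := by
  simp only [ambForm_eq_diagForm, map_zero]

theorem conormalForm_comm (v w : FlatAmbient n) : conormalForm c v w = conormalForm c w v := by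
  simp only [conormalForm, mul_comm v.1, real_inner_comm]

theorem conormalForm_add_right (v w w' : FlatAmbient n) :
    conormalForm c v (w + w') = conormalForm c v w + conormalForm c v w' := by
  simp only [conormalForm_eq_diagForm, map_add]

theorem conormalForm_sub_right (v w w' : FlatAmbient n) :
    conormalForm c v (w - w') = conormalForm c v w - conormalForm c v w' := by
  simp only [conormalForm_eq_diagForm, map_sub]

theorem conormalForm_smul_right (a : ℝ) (v w : FlatAmbient n) :
    conormalForm c v (a • w) = a * conormalForm c v w := by
  simp only [conormalForm_eq_diagForm, map_smul, smul_eq_mul]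

theorem conormalForm_eq_mul_ambForm (hc : c ≠ 0) (v w : FlatAmbient n) :
    conormalForm c v w = c * ambForm c v w := by
  rw [conormalForm, ambForm, mul_add, mul_inv_cancel_left₀ hc]

theorem conormalForm_self {x : FlatAmbient n} (hx : x ∈ spaceForm n c) :
    conormalForm c x x = 1 := by
  rw [conormalForm, real_inner_self_eq_norm_sq, ← hx.1, sq x.1]

theorem fst_eq_one_of_mem_spaceForm {x : FlatAmbient n} (hx : x ∈ spaceForm n 0) : x.1 = 1 := by
  have hsq : x.1 ^ 2 = 1 := by simpa using hx.1
  exact (pow_eq_one_iff_of_nonneg (hx.2 le_rfl).le two_ne_zero).1 hsq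

theorem fst_eq_zero_of_isTangentAt {x v : FlatAmbient n} (hx : x ∈ spaceForm n 0)
    (hv : IsTangentAt 0 x v) : v.1 = 0 := by
  simpa [IsTangentAt, conormalForm, fst_eq_one_of_mem_spaceForm hx] using hv

theorem conormalForm_of_isTangentAt {x v : FlatAmbient n} (hx : x ∈ spaceForm n c)
    (hv : IsTangentAt c x v) (w : FlatAmbient n) : conormalForm c v w = c * ambForm c v w := by
  obtain rfl | hc := eq_or_ne c 0
  · simp [conormalForm, fst_eq_zero_of_isTangentAt hx hv]
  · exact conormalForm_eq_mul_ambForm hc v w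

theorem mul_ambForm_eq_zero_of_isTangentAt {x v : FlatAmbient n} (hv : IsTangentAt c x v) :
    c * ambForm c x v = 0 := by
  obtain rfl | hc := eq_or_ne c 0
  · exact zero_mul _
  · rwa [← conormalForm_eq_mul_ambForm hc]

theorem mul_inner_sq_le (a : ℝ) {E : Type*} [NormedAddCommGroup E] [InnerProductSpace ℝ E]
    (x y : E) : (a * inner ℝ x y) ^ 2 ≤ (a * ‖x‖ ^ 2) * (a * ‖y‖ ^ 2) := by
  have h := sq_le_sq.2 ((abs_real_inner_le_norm x y).trans (le_abs_self _))
  calc (a * inner ℝ x y) ^ 2 = a ^ 2 * inner ℝ x y ^ 2 := mul_pow _ _ _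
    _ ≤ a ^ 2 * (‖x‖ * ‖y‖) ^ 2 := by gcongr
    _ = (a * ‖x‖ ^ 2) * (a * ‖y‖ ^ 2) := by ring

theorem ambForm_self (hc : c ≠ 0) (v : FlatAmbient n) :
    ambForm c v v = c⁻¹ * (v.1 ^ 2 + c * ‖v.2‖ ^ 2) := by
  rw [ambForm, real_inner_self_eq_norm_sq, mul_add, inv_mul_cancel_left₀ hc, sq v.1]

theorem ambForm_self_pos_of_pos (hc : 0 < c) {v : FlatAmbient n} (hv : v ≠ 0) :
    0 < ambForm c v v := by
  rw [ambForm_self hc.ne']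
  refine mul_pos (inv_pos.2 hc) ?_
  rcases not_and_or.1 (mt Prod.ext_iff.2 hv) with h | h
  · have : v.1 ≠ 0 := h
    positivity
  · have : v.2 ≠ 0 := h
    positivity

theorem ambForm_self_pos_of_neg (hc : c < 0) {x v : FlatAmbient n} (hx : x ∈ spaceForm n c)
    (hv : IsTangentAt c x v) (hne : v ≠ 0) : 0 < ambForm c v v := by
  have hx0 : 0 < x.1 := hx.2 hc.le
  have htan : x.1 * v.1 = -(c * inner ℝ x.2 v.2) := eq_neg_of_add_eq_zero_left hv
  have hv2 : v.2 ≠ 0 := by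
    intro h
    refine hne (Prod.ext ((mul_eq_zero.1 ?_).resolve_left hx0.ne') h)
    rw [htan, h, inner_zero_right, mul_zero, neg_zero]
  -- Cauchy-Schwarz, with `x₀ v₀ = -c x' · v'` and `x₀² = 1 - c|x'|²`.
  have hkey : x.1 ^ 2 * (v.1 ^ 2 + c * ‖v.2‖ ^ 2) ≤ c * ‖v.2‖ ^ 2 := by
    have hsq : (x.1 * v.1) ^ 2 ≤ (c * ‖x.2‖ ^ 2) * (c * ‖v.2‖ ^ 2) := by
      rw [htan, neg_sq]
      exact mul_inner_sq_le c x.2 v.2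
    rw [eq_sub_of_add_eq' hx.1] at hsq
    linarith
  have hneg : v.1 ^ 2 + c * ‖v.2‖ ^ 2 < 0 := by
    have : c * ‖v.2‖ ^ 2 < 0 := mul_neg_of_neg_of_pos hc (by positivity)
    exact neg_of_mul_neg_right (hkey.trans_lt this) (sq_nonneg _)
  rw [ambForm_self hc.ne]
  exact mul_pos_of_neg_of_neg (inv_lt_zero.2 hc) hneg

theorem ambForm_self_pos_of_isTangentAt {x v : FlatAmbient n} (hx : x ∈ spaceForm n c)
    (hv : IsTangentAt c x v) (hne : v ≠ 0) : 0 < ambForm c v v := by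
  obtain hc | rfl | hc := lt_trichotomy c 0
  · exact ambForm_self_pos_of_neg hc hx hv hne
  · have hv1 : v.1 = 0 := fst_eq_zero_of_isTangentAt hx hv
    have hv2 : v.2 ≠ 0 := fun h => hne (Prod.ext hv1 h)
    rw [ambForm, inv_zero, zero_mul, zero_add]
    exact real_inner_self_pos.2 hv2
  · exact ambForm_self_pos_of_pos hc hne

end Forms

/-! ### Directional derivatives -/

section DirDeriv

variable {V F : Type*} [NormedAddCommGroup V] [NormedSpace ℝ V] [NormedAddCommGroup F]
  [NormedSpace ℝ F] {n : ℕ} {c : ℝ}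

/-- The derivative of `f` in the constant direction `v`, as an operator on functions. -/
noncomputable def dirDeriv (v : V) (f : V → F) (z : V) : F := fderiv ℝ f z v

variable {f g : V → F} {z v : V} {Ω : Set V}

theorem differentiableAt_of_contDiffOn (hop : IsOpen Ω) (hf : ContDiffOn ℝ ∞ f Ω)
    (hz : z ∈ Ω) : DifferentiableAt ℝ f z :=
  (hf.contDiffAt (hop.mem_nhds hz)).differentiableAt (by simp)

theorem contDiffOn_dirDeriv (hop : IsOpen Ω) (hf : ContDiffOn ℝ ∞ f Ω) (v : V) :
    ContDiffOn ℝ ∞ (dirDeriv v f) Ω :=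
  (hf.fderiv_of_isOpen hop (by simp)).clm_apply contDiffOn_const

theorem dirDeriv_congr (hop : IsOpen Ω) (h : ∀ w ∈ Ω, f w = g w) (hz : z ∈ Ω) :
    dirDeriv v f z = dirDeriv v g z :=
  congrArg (fun L : V →L[ℝ] F => L v)
    (Filter.eventuallyEq_of_mem (hop.mem_nhds hz) h).fderiv_eq

theorem dirDeriv_const (a : F) : dirDeriv v (fun _ => a) z = 0 := by
  simp [dirDeriv]

theorem dirDeriv_add (hf : DifferentiableAt ℝ f z) (hg : DifferentiableAt ℝ g z) :
    dirDeriv v (fun w => f w + g w) z = dirDeriv v f z + dirDeriv v g z := by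
  simp only [dirDeriv, fderiv_fun_add hf hg, add_apply]

theorem dirDeriv_sub (hf : DifferentiableAt ℝ f z) (hg : DifferentiableAt ℝ g z) :
    dirDeriv v (fun w => f w - g w) z = dirDeriv v f z - dirDeriv v g z := by
  simp only [dirDeriv, fderiv_fun_sub hf hg, sub_apply]

theorem dirDeriv_smul {a : V → ℝ} (ha : DifferentiableAt ℝ a z) (hf : DifferentiableAt ℝ f z) :
    dirDeriv v (fun w => a w • f w) z = a z • dirDeriv v f z + dirDeriv v a z • f z := by
  simp only [dirDeriv, fderiv_fun_smul ha hf, add_apply,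
    smul_apply, ContinuousLinearMap.smulRight_apply]

theorem dirDeriv_const_smul (a : ℝ) (hf : DifferentiableAt ℝ f z) :
    dirDeriv v (fun w => a • f w) z = a • dirDeriv v f z := by
  simp only [dirDeriv, fderiv_fun_const_smul hf, smul_apply]

theorem dirDeriv_comm (hop : IsOpen Ω) (hf : ContDiffOn ℝ ∞ f Ω) (hz : z ∈ Ω) (v w : V) :
    dirDeriv v (dirDeriv w f) z = dirDeriv w (dirDeriv v f) z := by
  have hat : ContDiffAt ℝ ∞ f z := hf.contDiffAt (hop.mem_nhds hz)
  have hsymm : IsSymmSndFDerivAt ℝ f z := hat.isSymmSndFDerivAt (by simp [ENat.LEInfty.out])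
  have hd : DifferentiableAt ℝ (fderiv ℝ f) z :=
    (hat.fderiv_right (m := ∞) (by simp)).differentiableAt (by simp)
  have hsecond (v w : V) : dirDeriv v (dirDeriv w f) z = fderiv ℝ (fderiv ℝ f) z v w := by
    change fderiv ℝ (fun x => fderiv ℝ f x w) z v = _
    rw [fderiv_clm_apply hd (by fun_prop)]
    simp
  rw [hsecond, hsecond, hsymm.eq]

theorem dirDeriv_bilin {G₁ G₂ : Type*} [NormedAddCommGroup G₁] [NormedSpace ℝ G₁]
    [NormedAddCommGroup G₂] [NormedSpace ℝ G₂] (B : G₁ →L[ℝ] G₂ →L[ℝ] F) {f : V → G₁} {g : V → G₂}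
    (hf : DifferentiableAt ℝ f z) (hg : DifferentiableAt ℝ g z) :
    dirDeriv v (fun w => B (f w) (g w)) z =
      B (dirDeriv v f z) (g z) + B (f z) (dirDeriv v g z) := by
  rw [dirDeriv, B.fderiv_of_bilinear hf hg, add_comm]
  rfl

theorem dirDeriv_ambForm {f g : V → FlatAmbient n} (hf : DifferentiableAt ℝ f z)
    (hg : DifferentiableAt ℝ g z) :
    dirDeriv v (fun w => ambForm c (f w) (g w)) z =
      ambForm c (dirDeriv v f z) (g z) + ambForm c (f z) (dirDeriv v g z) := by
  simp only [ambForm_eq_diagForm, dirDeriv_bilin _ hf hg]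

theorem dirDeriv_conormalForm {f g : V → FlatAmbient n} (hf : DifferentiableAt ℝ f z)
    (hg : DifferentiableAt ℝ g z) :
    dirDeriv v (fun w => conormalForm c (f w) (g w)) z =
      conormalForm c (dirDeriv v f z) (g z) + conormalForm c (f z) (dirDeriv v g z) := by
  simp only [conormalForm_eq_diagForm, dirDeriv_bilin _ hf hg]

theorem contDiffOn_ambForm {f g : V → FlatAmbient n} (hf : ContDiffOn ℝ ∞ f Ω)
    (hg : ContDiffOn ℝ ∞ g Ω) : ContDiffOn ℝ ∞ (fun z => ambForm c (f z) (g z)) Ω :=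
  (contDiffOn_const.mul (hf.fst.mul hg.fst)).add (hf.snd.inner ℝ hg.snd)

theorem contDiffOn_conormalForm {f g : V → FlatAmbient n} (hf : ContDiffOn ℝ ∞ f Ω)
    (hg : ContDiffOn ℝ ∞ g Ω) : ContDiffOn ℝ ∞ (fun z => conormalForm c (f z) (g z)) Ω :=
  (hf.fst.mul hg.fst).add (contDiffOn_const.mul (hf.snd.inner ℝ hg.snd))

theorem isTangentAt_dirDeriv {f : V → FlatAmbient n} (hop : IsOpen Ω) (hf : ContDiffOn ℝ ∞ f Ω)
    (hmem : ∀ z ∈ Ω, f z ∈ spaceForm n c) (hz : z ∈ Ω) (v : V) :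
    IsTangentAt c (f z) (dirDeriv v f z) := by
  have hone := dirDeriv_congr (v := v) (g := fun _ => (1 : ℝ)) hop
    (fun w hw => conormalForm_self (hmem w hw)) hz
  have hd := differentiableAt_of_contDiffOn hop hf hz
  rw [dirDeriv_conormalForm hd hd, dirDeriv_const, conormalForm_comm (dirDeriv v f z)] at hone
  rw [IsTangentAt]
  linarith

end DirDeriv

/-! ### Orthogonal frames and the normal projection at a point -/

section Frame

variable {n : ℕ} {c : ℝ}

/-- `a`, `b` span a plane tangent to the space form at `x`, are orthogonal and of equal length. -/
structure IsConformalFrame (c : ℝ) (x a b : FlatAmbient n) : Prop where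
  mem : x ∈ spaceForm n c
  tangent_fst : IsTangentAt c x a
  tangent_snd : IsTangentAt c x b
  norm_eq : ambForm c a a = ambForm c b b
  orth : ambForm c a b = 0
  norm_ne : ambForm c a a ≠ 0

/-- `ξ` is tangent to the space form at `x` and orthogonal to `a` and `b`. -/
structure IsNormalVector (c : ℝ) (x a b ξ : FlatAmbient n) : Prop where
  tangent : IsTangentAt c x ξ
  orth_fst : ambForm c ξ a = 0
  orth_snd : ambForm c ξ b = 0

/-- The coefficient along the tangent vector `a` of the orthogonal projection of `X` to `ℝ a`. -/
noncomputable def tangentCoeff (c : ℝ) (x a X : FlatAmbient n) : ℝ :=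
  ambForm c (tangentProj c x X) a / ambForm c a a

/-- The projection of ambient vectors to the normal space of the plane spanned by `a` and `b`. -/
noncomputable def normalProj (c : ℝ) (x a b : FlatAmbient n) :
    FlatAmbient n →ₗ[ℝ] FlatAmbient n where
  toFun X := tangentProj c x X - tangentCoeff c x a X • a - tangentCoeff c x b X • b
  map_add' X Y := by
    simp only [tangentCoeff, tangentProj, conormalForm_add_right, ambForm_sub_left,
      ambForm_add_left, ambForm_smul_left]
    module
  map_smul' r X := by
    simp only [tangentCoeff, tangentProj, conormalForm_smul_right, ambForm_sub_left,
      ambForm_smul_left, RingHom.id_apply]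
    module

variable {x a b X ξ η : FlatAmbient n}

theorem normalProj_apply (x a b X : FlatAmbient n) : normalProj c x a b X =
    tangentProj c x X - tangentCoeff c x a X • a - tangentCoeff c x b X • b := rfl

theorem tangentProj_of_isTangentAt (h : IsTangentAt c x X) : tangentProj c x X = X := by
  rw [tangentProj, h, zero_smul, sub_zero]

theorem tangentCoeff_of_isTangentAt (h : IsTangentAt c x X) :
    tangentCoeff c x a X = ambForm c X a / ambForm c a a := by
  rw [tangentCoeff, tangentProj_of_isTangentAt h]

theorem ambForm_self_eq_zero_iff_of_isTangentAt (hx : x ∈ spaceForm n c) (h : IsTangentAt c x ξ) :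
    ambForm c ξ ξ = 0 ↔ ξ = 0 :=
  ⟨fun h0 => by_contra fun hne => (ambForm_self_pos_of_isTangentAt hx h hne).ne' h0,
    fun h0 => by rw [h0, ambForm_zero_right]⟩

theorem ambForm_self_nonneg_of_isTangentAt (hx : x ∈ spaceForm n c) (h : IsTangentAt c x ξ) :
    0 ≤ ambForm c ξ ξ := by
  obtain rfl | hne := eq_or_ne ξ 0
  · rw [ambForm_zero_right]
  · exact (ambForm_self_pos_of_isTangentAt hx h hne).le

namespace IsConformalFrame

variable (h : IsConformalFrame c x a b)
include h

theorem norm_ne_snd : ambForm c b b ≠ 0 := h.norm_eq ▸ h.norm_ne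

theorem normalProj_point : normalProj c x a b x = 0 := by
  have hx : tangentProj c x x = 0 := by
    rw [tangentProj, conormalForm_self h.mem, one_smul, sub_self]
  simp [normalProj_apply, tangentCoeff, hx, ambForm]

theorem normalProj_fst : normalProj c x a b a = 0 := by
  simp [normalProj_apply, tangentProj_of_isTangentAt h.tangent_fst,
    tangentCoeff_of_isTangentAt h.tangent_fst, h.orth, h.norm_ne]

theorem normalProj_snd : normalProj c x a b b = 0 := by
  simp [normalProj_apply, tangentProj_of_isTangentAt h.tangent_snd,
    tangentCoeff_of_isTangentAt h.tangent_snd, ambForm_comm b a, h.orth, h.norm_ne_snd]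

theorem isNormalVector_normalProj (X : FlatAmbient n) :
    IsNormalVector c x a b (normalProj c x a b X) where
  tangent := by
    have ha : conormalForm c x a = 0 := h.tangent_fst
    have hb : conormalForm c x b = 0 := h.tangent_snd
    simp only [IsTangentAt, normalProj_apply, tangentProj, conormalForm_sub_right,
      conormalForm_smul_right, ha, hb, conormalForm_self h.mem]
    ring
  orth_fst := by
    rw [normalProj_apply, ambForm_sub_left, ambForm_sub_left, ambForm_smul_left,
      ambForm_smul_left, ambForm_comm b a, h.orth, tangentCoeff, div_mul_cancel₀ _ h.norm_ne]
    ring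
  orth_snd := by
    rw [normalProj_apply, ambForm_sub_left, ambForm_sub_left, ambForm_smul_left,
      ambForm_smul_left, h.orth, tangentCoeff, tangentCoeff, div_mul_cancel₀ _ h.norm_ne_snd]
    ring

end IsConformalFrame

theorem normalProj_of_isNormalVector (h : IsNormalVector c x a b ξ) :
    normalProj c x a b ξ = ξ := by
  simp [normalProj_apply, tangentProj_of_isTangentAt h.tangent,
    tangentCoeff_of_isTangentAt h.tangent, h.orth_fst, h.orth_snd]

theorem ambForm_normalProj_of_isNormalVector (h : IsNormalVector c x a b η) :
    ambForm c η (normalProj c x a b X) = ambForm c η X - conormalForm c x X * ambForm c η x := by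
  simp only [normalProj_apply, tangentProj, ambForm_sub_right, ambForm_smul_right, h.orth_fst,
    h.orth_snd]
  ring

end Frame

/-! ### Conformal patches -/

local notation "∂₁" => dirDeriv (1 : ℂ)
local notation "∂₂" => dirDeriv Complex.I

section Patch

variable {n : ℕ}

/-- A conformal immersion of a plane domain into the space form. -/
structure IsConformalPatch (c : ℝ) (U : ℂ → FlatAmbient n) (Ω : Set ℂ) : Prop where
  isOpen : IsOpen Ω
  smooth : ContDiffOn ℝ ∞ U Ω
  mem : ∀ z ∈ Ω, U z ∈ spaceForm n c
  norm_eq : ∀ z ∈ Ω, ambForm c (∂₁ U z) (∂₁ U z) = ambForm c (∂₂ U z) (∂₂ U z)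
  orth : ∀ z ∈ Ω, ambForm c (∂₁ U z) (∂₂ U z) = 0
  norm_ne : ∀ z ∈ Ω, ambForm c (∂₁ U z) (∂₁ U z) ≠ 0

/-- The projection to the normal space of a patch at the parameter `z`. -/
noncomputable def patchNormal (c : ℝ) (U : ℂ → FlatAmbient n) (z : ℂ) :
    FlatAmbient n →ₗ[ℝ] FlatAmbient n :=
  normalProj c (U z) (∂₁ U z) (∂₂ U z)

/-- Smooth sections of the normal bundle of a patch. -/
structure IsPatchNormalField (c : ℝ) (U : ℂ → FlatAmbient n) (Ω : Set ℂ)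
    (ξ : ℂ → FlatAmbient n) : Prop where
  smooth : ContDiffOn ℝ ∞ ξ Ω
  normal : ∀ z ∈ Ω, IsNormalVector c (U z) (∂₁ U z) (∂₂ U z) (ξ z)

/-- The conformal factor `|∂₁U|²` of a patch. -/
noncomputable def confFactor (c : ℝ) (U : ℂ → FlatAmbient n) (z : ℂ) : ℝ :=
  ambForm c (∂₁ U z) (∂₁ U z)

/-- The derivative of `log |∂₁U|` in the direction `v`.  The Christoffel symbols of a patch are
`±` these functions. -/
noncomputable def confLogDeriv (c : ℝ) (U : ℂ → FlatAmbient n) (v z : ℂ) : ℝ :=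
  dirDeriv v (confFactor c U) z / (2 * confFactor c U z)

/-- The normal connection `∇^⊥_v ξ` of a patch. -/
noncomputable def patchNormalDeriv (c : ℝ) (U : ℂ → FlatAmbient n) (v : ℂ)
    (ξ : ℂ → FlatAmbient n) (z : ℂ) : FlatAmbient n :=
  patchNormal c U z (dirDeriv v ξ z)

/-- The second fundamental form `A(∂_v U, ∂_w U)` of a patch. -/
noncomputable def patchSecondForm (c : ℝ) (U : ℂ → FlatAmbient n) (v w : ℂ) :
    ℂ → FlatAmbient n :=
  patchNormalDeriv c U v (dirDeriv w U)

/-- The mean curvature vector of a patch. -/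
noncomputable def patchMeanCurvature (c : ℝ) (U : ℂ → FlatAmbient n) (z : ℂ) : FlatAmbient n :=
  (2 * confFactor c U z)⁻¹ •
    (patchSecondForm c U 1 1 z + patchSecondForm c U Complex.I Complex.I z)

/-- The real part `A(∂₁,∂₁) - A(∂₂,∂₂)` of the normal-valued Hopf differential. -/
noncomputable def hopfRe (c : ℝ) (U : ℂ → FlatAmbient n) (z : ℂ) : FlatAmbient n :=
  patchSecondForm c U 1 1 z - patchSecondForm c U Complex.I Complex.I z

/-- The negative `2 A(∂₁,∂₂)` of the imaginary part of the normal-valued Hopf differential. -/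
noncomputable def hopfIm (c : ℝ) (U : ℂ → FlatAmbient n) (z : ℂ) : FlatAmbient n :=
  (2 : ℝ) • patchSecondForm c U 1 Complex.I z

variable {c : ℝ} {U : ℂ → FlatAmbient n} {Ω : Set ℂ} {z : ℂ} {f g ξ η : ℂ → FlatAmbient n}

theorem dirDeriv_eq_re_smul_add_im_smul {F : Type*} [NormedAddCommGroup F] [NormedSpace ℝ F]
    (f : ℂ → F) (v z : ℂ) : dirDeriv v f z = v.re • ∂₁ f z + v.im • ∂₂ f z := by
  have hv : v = v.re • (1 : ℂ) + v.im • Complex.I := by simp [Complex.re_add_im]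
  simp only [dirDeriv]
  rw [← map_smul, ← map_smul, ← map_add, ← hv]

theorem patchNormalDeriv_add (hf : DifferentiableAt ℝ f z) (hg : DifferentiableAt ℝ g z) (v : ℂ) :
    patchNormalDeriv c U v (fun w => f w + g w) z =
      patchNormalDeriv c U v f z + patchNormalDeriv c U v g z := by
  simp only [patchNormalDeriv, dirDeriv_add hf hg, map_add]

theorem patchNormalDeriv_sub (hf : DifferentiableAt ℝ f z) (hg : DifferentiableAt ℝ g z) (v : ℂ) :
    patchNormalDeriv c U v (fun w => f w - g w) z =
      patchNormalDeriv c U v f z - patchNormalDeriv c U v g z := by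
  simp only [patchNormalDeriv, dirDeriv_sub hf hg, map_sub]

theorem patchNormalDeriv_smul {a : ℂ → ℝ} (ha : DifferentiableAt ℝ a z)
    (hf : DifferentiableAt ℝ f z) (v : ℂ) :
    patchNormalDeriv c U v (fun w => a w • f w) z =
      a z • patchNormalDeriv c U v f z + dirDeriv v a z • patchNormal c U z (f z) := by
  simp only [patchNormalDeriv, dirDeriv_smul ha hf, map_add, map_smul]

theorem patchNormalDeriv_congr (hop : IsOpen Ω) (h : ∀ w ∈ Ω, f w = g w) (hz : z ∈ Ω) (v : ℂ) :
    patchNormalDeriv c U v f z = patchNormalDeriv c U v g z := by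
  rw [patchNormalDeriv, dirDeriv_congr hop h hz, patchNormalDeriv]

namespace IsPatchNormalField

theorem patchNormal_eq (hξ : IsPatchNormalField c U Ω ξ) (hz : z ∈ Ω) :
    patchNormal c U z (ξ z) = ξ z :=
  normalProj_of_isNormalVector (hξ.normal z hz)

theorem ambForm_dirDeriv_eq_zero (hξ : IsPatchNormalField c U Ω ξ) (hz : z ∈ Ω) (v : ℂ) :
    ambForm c (ξ z) (dirDeriv v U z) = 0 := by
  rw [dirDeriv_eq_re_smul_add_im_smul, ambForm_add_right, ambForm_smul_right, ambForm_smul_right,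
    (hξ.normal z hz).orth_fst, (hξ.normal z hz).orth_snd, mul_zero, mul_zero, add_zero]

end IsPatchNormalField

namespace IsConformalPatch

variable (h : IsConformalPatch c U Ω)
include h

theorem differentiableAt {F : Type*} [NormedAddCommGroup F] [NormedSpace ℝ F] {f : ℂ → F}
    (hf : ContDiffOn ℝ ∞ f Ω) (hz : z ∈ Ω) : DifferentiableAt ℝ f z :=
  differentiableAt_of_contDiffOn h.isOpen hf hz

protected theorem contDiffOn_dirDeriv (v : ℂ) : ContDiffOn ℝ ∞ (dirDeriv v U) Ω :=
  contDiffOn_dirDeriv h.isOpen h.smooth v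

theorem contDiffOn_dirDeriv_dirDeriv (v w : ℂ) : ContDiffOn ℝ ∞ (dirDeriv v (dirDeriv w U)) Ω :=
  contDiffOn_dirDeriv h.isOpen (h.contDiffOn_dirDeriv w) v

protected theorem isTangentAt_dirDeriv (hz : z ∈ Ω) (v : ℂ) :
    IsTangentAt c (U z) (dirDeriv v U z) :=
  isTangentAt_dirDeriv h.isOpen h.smooth h.mem hz v

theorem isConformalFrame (hz : z ∈ Ω) : IsConformalFrame c (U z) (∂₁ U z) (∂₂ U z) :=
  ⟨h.mem z hz, h.isTangentAt_dirDeriv hz 1, h.isTangentAt_dirDeriv hz _, h.norm_eq z hz,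
    h.orth z hz, h.norm_ne z hz⟩

theorem patchNormal_point (hz : z ∈ Ω) : patchNormal c U z (U z) = 0 :=
  (h.isConformalFrame hz).normalProj_point

theorem patchNormalDeriv_self (hz : z ∈ Ω) (v : ℂ) : patchNormalDeriv c U v U z = 0 := by
  rw [patchNormalDeriv, dirDeriv_eq_re_smul_add_im_smul, map_add, map_smul, map_smul, patchNormal,
    (h.isConformalFrame hz).normalProj_fst, (h.isConformalFrame hz).normalProj_snd, smul_zero,
    smul_zero, add_zero]

protected theorem contDiffOn_conormalForm (hf : ContDiffOn ℝ ∞ f Ω) :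
    ContDiffOn ℝ ∞ (fun z => conormalForm c (U z) (f z)) Ω :=
  contDiffOn_conormalForm h.smooth hf

theorem contDiffOn_tangentCoeff (hf : ContDiffOn ℝ ∞ f Ω) {v : ℂ}
    (hv : ∀ z ∈ Ω, ambForm c (dirDeriv v U z) (dirDeriv v U z) ≠ 0) :
    ContDiffOn ℝ ∞ (fun z => tangentCoeff c (U z) (dirDeriv v U z) (f z)) Ω :=
  (contDiffOn_ambForm (hf.sub ((h.contDiffOn_conormalForm hf).smul h.smooth))
    (h.contDiffOn_dirDeriv v)).div
      (contDiffOn_ambForm (h.contDiffOn_dirDeriv v) (h.contDiffOn_dirDeriv v)) hv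

theorem contDiffOn_tangentCoeff_fst (hf : ContDiffOn ℝ ∞ f Ω) :
    ContDiffOn ℝ ∞ (fun z => tangentCoeff c (U z) (∂₁ U z) (f z)) Ω :=
  h.contDiffOn_tangentCoeff hf h.norm_ne

theorem contDiffOn_tangentCoeff_snd (hf : ContDiffOn ℝ ∞ f Ω) :
    ContDiffOn ℝ ∞ (fun z => tangentCoeff c (U z) (∂₂ U z) (f z)) Ω :=
  h.contDiffOn_tangentCoeff hf fun _ hz => (h.isConformalFrame hz).norm_ne_snd

theorem contDiffOn_patchNormal (hf : ContDiffOn ℝ ∞ f Ω) :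
    ContDiffOn ℝ ∞ (fun z => patchNormal c U z (f z)) Ω :=
  ((hf.sub ((h.contDiffOn_conormalForm hf).smul h.smooth)).sub
    ((h.contDiffOn_tangentCoeff_fst hf).smul (h.contDiffOn_dirDeriv 1))).sub
      ((h.contDiffOn_tangentCoeff_snd hf).smul (h.contDiffOn_dirDeriv _))

theorem isPatchNormalField_patchNormal (hf : ContDiffOn ℝ ∞ f Ω) :
    IsPatchNormalField c U Ω (fun z => patchNormal c U z (f z)) :=
  ⟨h.contDiffOn_patchNormal hf, fun _ hz => (h.isConformalFrame hz).isNormalVector_normalProj _⟩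

theorem patchNormalDeriv_patchNormal (hf : ContDiffOn ℝ ∞ f Ω) (hz : z ∈ Ω) (v : ℂ) :
    patchNormalDeriv c U v (fun w => patchNormal c U w (f w)) z =
      patchNormalDeriv c U v f z
        - tangentCoeff c (U z) (∂₁ U z) (f z) • patchSecondForm c U v 1 z
        - tangentCoeff c (U z) (∂₂ U z) (f z) • patchSecondForm c U v Complex.I z := by
  have hU := h.differentiableAt h.smooth hz
  have hU₁ := h.differentiableAt (h.contDiffOn_dirDeriv 1) hz
  have hU₂ := h.differentiableAt (h.contDiffOn_dirDeriv Complex.I) hz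
  have hfz := h.differentiableAt hf hz
  have hq := h.differentiableAt (h.contDiffOn_conormalForm hf) hz
  have ht₁ := h.differentiableAt (h.contDiffOn_tangentCoeff_fst hf) hz
  have ht₂ := h.differentiableAt (h.contDiffOn_tangentCoeff_snd hf) hz
  have h₁ : patchNormal c U z (∂₁ U z) = 0 := h.patchNormalDeriv_self hz 1
  have h₂ : patchNormal c U z (∂₂ U z) = 0 := h.patchNormalDeriv_self hz Complex.I
  simp only [patchNormal, normalProj_apply, tangentProj]
  rw [patchNormalDeriv_sub ((hfz.fun_sub (hq.fun_smul hU)).fun_sub (ht₁.fun_smul hU₁))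
      (ht₂.fun_smul hU₂), patchNormalDeriv_sub (hfz.fun_sub (hq.fun_smul hU)) (ht₁.fun_smul hU₁),
    patchNormalDeriv_sub hfz (hq.fun_smul hU), patchNormalDeriv_smul hq hU,
    patchNormalDeriv_smul ht₁ hU₁, patchNormalDeriv_smul ht₂ hU₂, h.patchNormal_point hz,
    h.patchNormalDeriv_self hz, h₁, h₂, patchSecondForm, patchSecondForm]
  module

end IsConformalPatch

end Patch

/-! ### The equations of Codazzi and Ricci -/

section StructureEquations

variable {n : ℕ} {c : ℝ} {U : ℂ → FlatAmbient n} {Ω : Set ℂ} {z : ℂ} {f ξ η : ℂ → FlatAmbient n}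

namespace IsConformalPatch

variable (h : IsConformalPatch c U Ω)
include h

theorem conormalForm_dirDeriv_of_isTangentAt (hf : ContDiffOn ℝ ∞ f Ω)
    (ht : ∀ w ∈ Ω, IsTangentAt c (U w) (f w)) (hz : z ∈ Ω) (v : ℂ) :
    conormalForm c (U z) (dirDeriv v f z) = -(c * ambForm c (dirDeriv v U z) (f z)) := by
  have hzero := dirDeriv_congr (v := v) (g := fun _ => (0 : ℝ)) h.isOpen ht hz
  rw [dirDeriv_conormalForm (h.differentiableAt h.smooth hz) (h.differentiableAt hf hz),
    dirDeriv_const, conormalForm_of_isTangentAt (h.mem z hz) (h.isTangentAt_dirDeriv hz v)]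
    at hzero
  linarith

theorem tangentCoeff_dirDeriv_of_isTangentAt (hf : ContDiffOn ℝ ∞ f Ω)
    (ht : ∀ w ∈ Ω, IsTangentAt c (U w) (f w)) (hz : z ∈ Ω) (v k : ℂ) :
    tangentCoeff c (U z) (dirDeriv k U z) (dirDeriv v f z) =
      ambForm c (dirDeriv v f z) (dirDeriv k U z) /
        ambForm c (dirDeriv k U z) (dirDeriv k U z) := by
  have hk := mul_ambForm_eq_zero_of_isTangentAt (h.isTangentAt_dirDeriv hz k)
  rw [tangentCoeff, tangentProj, ambForm_sub_left, ambForm_smul_left,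
    h.conormalForm_dirDeriv_of_isTangentAt hf ht hz]
  congr 1
  linear_combination ambForm c (dirDeriv v U z) (f z) * hk

theorem ambForm_patchNormalDeriv_of_isTangentAt (hξ : IsPatchNormalField c U Ω ξ)
    (hf : ContDiffOn ℝ ∞ f Ω) (ht : ∀ w ∈ Ω, IsTangentAt c (U w) (f w)) (hz : z ∈ Ω) (v : ℂ) :
    ambForm c (ξ z) (patchNormalDeriv c U v f z) = ambForm c (ξ z) (dirDeriv v f z) := by
  have hk := mul_ambForm_eq_zero_of_isTangentAt (hξ.normal z hz).tangent
  rw [patchNormalDeriv, patchNormal, ambForm_normalProj_of_isNormalVector (hξ.normal z hz),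
    h.conormalForm_dirDeriv_of_isTangentAt hf ht hz, ambForm_comm (ξ z) (U z)]
  linear_combination ambForm c (dirDeriv v U z) (f z) * hk

theorem dirDeriv_ambForm_of_normal (hξ : IsPatchNormalField c U Ω ξ)
    (hη : IsPatchNormalField c U Ω η) (hz : z ∈ Ω) (v : ℂ) :
    dirDeriv v (fun w => ambForm c (ξ w) (η w)) z =
      ambForm c (patchNormalDeriv c U v ξ z) (η z) +
        ambForm c (ξ z) (patchNormalDeriv c U v η z) := by
  rw [dirDeriv_ambForm (h.differentiableAt hξ.smooth hz) (h.differentiableAt hη.smooth hz),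
    ambForm_comm (patchNormalDeriv c U v ξ z),
    h.ambForm_patchNormalDeriv_of_isTangentAt hξ hη.smooth (fun w hw => (hη.normal w hw).tangent)
      hz,
    h.ambForm_patchNormalDeriv_of_isTangentAt hη hξ.smooth (fun w hw => (hξ.normal w hw).tangent)
      hz, ambForm_comm (η z)]

theorem isPatchNormalField_patchSecondForm (v w : ℂ) :
    IsPatchNormalField c U Ω (patchSecondForm c U v w) :=
  h.isPatchNormalField_patchNormal (h.contDiffOn_dirDeriv_dirDeriv v w)

theorem patchSecondForm_comm (hz : z ∈ Ω) (v w : ℂ) :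
    patchSecondForm c U v w z = patchSecondForm c U w v z :=
  congrArg (patchNormal c U z) (dirDeriv_comm h.isOpen h.smooth hz v w)

theorem ambForm_dirDeriv_fst_fst (hz : z ∈ Ω) (v : ℂ) :
    ambForm c (dirDeriv v (∂₁ U) z) (∂₁ U z) = dirDeriv v (confFactor c U) z / 2 := by
  have hd := h.differentiableAt (h.contDiffOn_dirDeriv 1) hz
  have hv : dirDeriv v (confFactor c U) z = _ := dirDeriv_ambForm hd hd
  rw [ambForm_comm (∂₁ U z)] at hv
  linarith

theorem ambForm_dirDeriv_snd_snd (hz : z ∈ Ω) (v : ℂ) :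
    ambForm c (dirDeriv v (∂₂ U) z) (∂₂ U z) = dirDeriv v (confFactor c U) z / 2 := by
  have hd := h.differentiableAt (h.contDiffOn_dirDeriv Complex.I) hz
  have hv := dirDeriv_ambForm (c := c) (v := v) hd hd
  rw [← dirDeriv_congr (f := confFactor c U) h.isOpen h.norm_eq hz, ambForm_comm (∂₂ U z)] at hv
  linarith

theorem ambForm_dirDeriv_fst_snd (hz : z ∈ Ω) (v : ℂ) :
    ambForm c (dirDeriv v (∂₁ U) z) (∂₂ U z) = -ambForm c (dirDeriv v (∂₂ U) z) (∂₁ U z) := by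
  have hv := dirDeriv_ambForm (c := c) (v := v) (h.differentiableAt (h.contDiffOn_dirDeriv 1) hz)
    (h.differentiableAt (h.contDiffOn_dirDeriv Complex.I) hz)
  rw [ambForm_comm (∂₁ U z), dirDeriv_congr (g := fun _ => (0 : ℝ)) h.isOpen h.orth hz,
    dirDeriv_const] at hv
  linarith

theorem tangentCoeff_dirDeriv_dirDeriv (hz : z ∈ Ω) (v w k : ℂ) :
    tangentCoeff c (U z) (dirDeriv k U z) (dirDeriv v (dirDeriv w U) z) =
      ambForm c (dirDeriv v (dirDeriv w U) z) (dirDeriv k U z) /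
        ambForm c (dirDeriv k U z) (dirDeriv k U z) :=
  h.tangentCoeff_dirDeriv_of_isTangentAt (h.contDiffOn_dirDeriv w)
    (fun _ hx => h.isTangentAt_dirDeriv hx w) hz v k

theorem tangentCoeff_fst_fst (hz : z ∈ Ω) (v : ℂ) :
    tangentCoeff c (U z) (∂₁ U z) (dirDeriv v (∂₁ U) z) = confLogDeriv c U v z := by
  rw [h.tangentCoeff_dirDeriv_dirDeriv hz, h.ambForm_dirDeriv_fst_fst hz, confLogDeriv, div_div,
    confFactor]

theorem tangentCoeff_snd_snd (hz : z ∈ Ω) (v : ℂ) :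
    tangentCoeff c (U z) (∂₂ U z) (dirDeriv v (∂₂ U) z) = confLogDeriv c U v z := by
  rw [h.tangentCoeff_dirDeriv_dirDeriv hz, h.ambForm_dirDeriv_snd_snd hz, confLogDeriv, div_div,
    confFactor, h.norm_eq z hz]

theorem tangentCoeff_snd_fst (hz : z ∈ Ω) (v : ℂ) :
    tangentCoeff c (U z) (∂₂ U z) (dirDeriv v (∂₁ U) z) =
      -tangentCoeff c (U z) (∂₁ U z) (dirDeriv v (∂₂ U) z) := by
  rw [h.tangentCoeff_dirDeriv_dirDeriv hz, h.tangentCoeff_dirDeriv_dirDeriv hz,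
    h.ambForm_dirDeriv_fst_snd hz, h.norm_eq z hz, neg_div]

theorem tangentCoeff_fst_fst_snd (hz : z ∈ Ω) :
    tangentCoeff c (U z) (∂₁ U z) (∂₁ (∂₂ U) z) = confLogDeriv c U Complex.I z := by
  rw [dirDeriv_comm h.isOpen h.smooth hz, h.tangentCoeff_fst_fst hz]

theorem tangentCoeff_fst_snd_snd (hz : z ∈ Ω) :
    tangentCoeff c (U z) (∂₁ U z) (∂₂ (∂₂ U) z) = -confLogDeriv c U 1 z := by
  rw [← h.tangentCoeff_snd_snd hz, dirDeriv_comm h.isOpen h.smooth hz 1, h.tangentCoeff_snd_fst hz,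
    neg_neg]

theorem codazzi (hz : z ∈ Ω) (v w k : ℂ) :
    patchNormalDeriv c U v (patchSecondForm c U w k) z
        + tangentCoeff c (U z) (∂₁ U z) (dirDeriv w (dirDeriv k U) z) • patchSecondForm c U v 1 z
        + tangentCoeff c (U z) (∂₂ U z) (dirDeriv w (dirDeriv k U) z) •
          patchSecondForm c U v Complex.I z =
      patchNormalDeriv c U w (patchSecondForm c U v k) z
        + tangentCoeff c (U z) (∂₁ U z) (dirDeriv v (dirDeriv k U) z) • patchSecondForm c U w 1 z
        + tangentCoeff c (U z) (∂₂ U z) (dirDeriv v (dirDeriv k U) z) •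
          patchSecondForm c U w Complex.I z := by
  -- Both sides are the normal part of the third derivative `∂_v ∂_w ∂_k U`.
  have hA (v w : ℂ) := h.patchNormalDeriv_patchNormal (h.contDiffOn_dirDeriv_dirDeriv w k) hz v
  have hthird : patchNormalDeriv c U v (dirDeriv w (dirDeriv k U)) z =
      patchNormalDeriv c U w (dirDeriv v (dirDeriv k U)) z :=
    congrArg (patchNormal c U z) (dirDeriv_comm h.isOpen (h.contDiffOn_dirDeriv k) hz v w)
  have hvw : patchNormalDeriv c U v (patchSecondForm c U w k) z = _ := hA v w
  have hwv : patchNormalDeriv c U w (patchSecondForm c U v k) z = _ := hA w v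
  rw [hvw, hwv, hthird]
  module

theorem codazzi_fst (hz : z ∈ Ω) :
    patchNormalDeriv c U 1 (patchSecondForm c U 1 Complex.I) z =
      patchNormalDeriv c U Complex.I (patchSecondForm c U 1 1) z - confLogDeriv c U Complex.I z •
        (patchSecondForm c U 1 1 z + patchSecondForm c U Complex.I Complex.I z) := by
  have hcod := h.codazzi hz 1 Complex.I 1
  rw [h.tangentCoeff_fst_fst hz, h.tangentCoeff_fst_fst hz, h.tangentCoeff_snd_fst hz,
    h.tangentCoeff_snd_fst hz, h.tangentCoeff_fst_fst_snd hz, h.tangentCoeff_fst_snd_snd hz,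
    patchNormalDeriv_congr h.isOpen (fun w hw => h.patchSecondForm_comm hw Complex.I 1) hz,
    h.patchSecondForm_comm hz Complex.I 1] at hcod
  linear_combination (norm := module) hcod

theorem codazzi_snd (hz : z ∈ Ω) :
    patchNormalDeriv c U Complex.I (patchSecondForm c U 1 Complex.I) z =
      patchNormalDeriv c U 1 (patchSecondForm c U Complex.I Complex.I) z - confLogDeriv c U 1 z •
        (patchSecondForm c U 1 1 z + patchSecondForm c U Complex.I Complex.I z) := by
  have hcod := h.codazzi hz Complex.I 1 Complex.I
  rw [h.tangentCoeff_snd_snd hz, h.tangentCoeff_snd_snd hz, h.tangentCoeff_fst_fst_snd hz,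
    h.tangentCoeff_fst_snd_snd hz, h.patchSecondForm_comm hz Complex.I 1] at hcod
  linear_combination (norm := module) hcod

theorem tangentCoeff_dirDeriv_of_normal (hξ : IsPatchNormalField c U Ω ξ) (hz : z ∈ Ω) (v k : ℂ) :
    tangentCoeff c (U z) (dirDeriv k U z) (dirDeriv v ξ z) =
      -ambForm c (ξ z) (patchSecondForm c U v k z) /
        ambForm c (dirDeriv k U z) (dirDeriv k U z) := by
  have hzero := dirDeriv_congr (v := v) (g := fun _ => (0 : ℝ)) h.isOpen
    (fun w hw => hξ.ambForm_dirDeriv_eq_zero hw k) hz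
  rw [dirDeriv_ambForm (h.differentiableAt hξ.smooth hz)
    (h.differentiableAt (h.contDiffOn_dirDeriv k) hz), dirDeriv_const] at hzero
  rw [h.tangentCoeff_dirDeriv_of_isTangentAt hξ.smooth (fun w hw => (hξ.normal w hw).tangent) hz,
    patchSecondForm, h.ambForm_patchNormalDeriv_of_isTangentAt hξ (h.contDiffOn_dirDeriv k)
      (fun w hw => h.isTangentAt_dirDeriv hw k) hz, eq_neg_of_add_eq_zero_left hzero]

theorem patchNormalDeriv_patchNormalDeriv (hξ : IsPatchNormalField c U Ω ξ) (hz : z ∈ Ω)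
    (v w : ℂ) :
    patchNormalDeriv c U v (patchNormalDeriv c U w ξ) z =
      patchNormalDeriv c U v (dirDeriv w ξ) z + (confFactor c U z)⁻¹ •
        (ambForm c (ξ z) (patchSecondForm c U w 1 z) • patchSecondForm c U v 1 z
          + ambForm c (ξ z) (patchSecondForm c U w Complex.I z) •
            patchSecondForm c U v Complex.I z) := by
  have hN : patchNormalDeriv c U v (patchNormalDeriv c U w ξ) z = _ :=
    h.patchNormalDeriv_patchNormal (contDiffOn_dirDeriv h.isOpen hξ.smooth w) hz v
  rw [hN, h.tangentCoeff_dirDeriv_of_normal hξ hz, h.tangentCoeff_dirDeriv_of_normal hξ hz,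
    ← h.norm_eq z hz, confFactor]
  module

theorem ricci (hξ : IsPatchNormalField c U Ω ξ) (hz : z ∈ Ω) :
    patchNormalDeriv c U 1 (patchNormalDeriv c U Complex.I ξ) z
        - patchNormalDeriv c U Complex.I (patchNormalDeriv c U 1 ξ) z =
      (2 * confFactor c U z)⁻¹ • (ambForm c (ξ z) (hopfIm c U z) • hopfRe c U z
        - ambForm c (ξ z) (hopfRe c U z) • hopfIm c U z) := by
  have hsecond : patchNormalDeriv c U 1 (dirDeriv Complex.I ξ) z =
      patchNormalDeriv c U Complex.I (dirDeriv 1 ξ) z :=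
    congrArg (patchNormal c U z) (dirDeriv_comm h.isOpen hξ.smooth hz 1 Complex.I)
  rw [h.patchNormalDeriv_patchNormalDeriv hξ hz, h.patchNormalDeriv_patchNormalDeriv hξ hz,
    hsecond, h.patchSecondForm_comm hz Complex.I 1, hopfRe, hopfIm, ambForm_smul_right,
    ambForm_sub_right]
  match_scalars <;> ring

end IsConformalPatch

end StructureEquations

/-! ### Parallel mean curvature and flat normal bundle -/

section ParallelFlat

variable {n : ℕ}

/-- A conformal patch with parallel mean curvature vector and flat normal connection. -/
structure IsParallelFlatPatch (c : ℝ) (U : ℂ → FlatAmbient n) (Ω : Set ℂ) : Prop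
    extends IsConformalPatch c U Ω where
  parallel : ∀ z ∈ Ω, ∀ v, patchNormalDeriv c U v (patchMeanCurvature c U) z = 0
  flat : ∀ ξ, IsPatchNormalField c U Ω ξ → ∀ z ∈ Ω,
    patchNormalDeriv c U 1 (patchNormalDeriv c U Complex.I ξ) z =
      patchNormalDeriv c U Complex.I (patchNormalDeriv c U 1 ξ) z

/-- The quartic differential `⟨φ, φ⟩`, where `φ = α - iγ` is the normal-valued Hopf differential
with `α = hopfRe` and `γ = hopfIm`. -/
noncomputable def hopfQuartic (c : ℝ) (U : ℂ → FlatAmbient n) (z : ℂ) : ℂ :=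
  ⟨ambForm c (hopfRe c U z) (hopfRe c U z) - ambForm c (hopfIm c U z) (hopfIm c U z),
    -2 * ambForm c (hopfRe c U z) (hopfIm c U z)⟩

variable {c : ℝ} {U : ℂ → FlatAmbient n} {Ω : Set ℂ} {z : ℂ} {ξ η : ℂ → FlatAmbient n}

theorem differentiableAt_mk_of_cauchyRiemann {p q : ℂ → ℝ} (hp : DifferentiableAt ℝ p z)
    (hq : DifferentiableAt ℝ q z) (h₁ : ∂₁ p z = ∂₂ q z) (h₂ : ∂₂ p z = -∂₁ q z) :
    DifferentiableAt ℂ (fun w => (⟨p w, q w⟩ : ℂ)) z := by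
  have hpq : (fun w => (⟨p w, q w⟩ : ℂ)) = fun w => p w • (1 : ℂ) + q w • Complex.I := by
    funext w
    simp [Complex.mk_eq_add_mul_I]
  have hp' := hp.fun_smul (differentiableAt_const (c := (1 : ℂ)))
  have hq' := hq.fun_smul (differentiableAt_const (c := Complex.I))
  rw [hpq]
  refine differentiableAt_complex_iff_differentiableAt_real.2 ⟨hp'.fun_add hq', ?_⟩
  change ∂₂ _ z = Complex.I • ∂₁ _ z
  rw [dirDeriv_add hp' hq', dirDeriv_add hp' hq', dirDeriv_smul hp (differentiableAt_const _),
    dirDeriv_smul hq (differentiableAt_const _), dirDeriv_smul hp (differentiableAt_const _),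
    dirDeriv_smul hq (differentiableAt_const _), dirDeriv_const, dirDeriv_const, dirDeriv_const,
    dirDeriv_const, h₁, h₂]
  apply Complex.ext <;> simp

namespace IsConformalPatch

section

variable (h : IsConformalPatch c U Ω)
include h

theorem contDiffOn_confFactor : ContDiffOn ℝ ∞ (confFactor c U) Ω :=
  contDiffOn_ambForm (h.contDiffOn_dirDeriv 1) (h.contDiffOn_dirDeriv 1)

theorem isPatchNormalField_hopfRe : IsPatchNormalField c U Ω (hopfRe c U) := by
  have hα : hopfRe c U = fun z => patchNormal c U z (∂₁ (∂₁ U) z - ∂₂ (∂₂ U) z) :=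
    funext fun z => (map_sub (patchNormal c U z) _ _).symm
  exact hα ▸ h.isPatchNormalField_patchNormal
    ((h.contDiffOn_dirDeriv_dirDeriv 1 1).sub (h.contDiffOn_dirDeriv_dirDeriv _ _))

theorem isPatchNormalField_hopfIm : IsPatchNormalField c U Ω (hopfIm c U) := by
  have hγ : hopfIm c U = fun z => patchNormal c U z ((2 : ℝ) • ∂₁ (∂₂ U) z) :=
    funext fun z => (map_smul (patchNormal c U z) _ _).symm
  exact hγ ▸ h.isPatchNormalField_patchNormal
    ((h.contDiffOn_dirDeriv_dirDeriv 1 Complex.I).const_smul (2 : ℝ))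

theorem isPatchNormalField_patchMeanCurvature :
    IsPatchNormalField c U Ω (patchMeanCurvature c U) := by
  have hH : patchMeanCurvature c U = fun z =>
      patchNormal c U z ((2 * confFactor c U z)⁻¹ • (∂₁ (∂₁ U) z + ∂₂ (∂₂ U) z)) := by
    funext z
    rw [map_smul, map_add]
    rfl
  have hlam : ContDiffOn ℝ ∞ (fun z => (2 * confFactor c U z)⁻¹) Ω :=
    (contDiffOn_const.mul h.contDiffOn_confFactor).inv
      fun z hz => mul_ne_zero two_ne_zero (h.norm_ne z hz)
  exact hH ▸ h.isPatchNormalField_patchNormal (hlam.smul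
    ((h.contDiffOn_dirDeriv_dirDeriv 1 1).add (h.contDiffOn_dirDeriv_dirDeriv _ _)))

theorem patchSecondForm_fst_fst_add_snd_snd (hz : z ∈ Ω) :
    patchSecondForm c U 1 1 z + patchSecondForm c U Complex.I Complex.I z =
      (2 * confFactor c U z) • patchMeanCurvature c U z :=
  (smul_inv_smul₀ (mul_ne_zero two_ne_zero (h.norm_ne z hz)) _).symm

theorem patchNormalDeriv_smul_of_normal {a : ℂ → ℝ} (ha : ContDiffOn ℝ ∞ a Ω)
    (hξ : IsPatchNormalField c U Ω ξ) (hz : z ∈ Ω) (v : ℂ) :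
    patchNormalDeriv c U v (fun w => a w • ξ w) z =
      a z • patchNormalDeriv c U v ξ z + dirDeriv v a z • ξ z := by
  rw [patchNormalDeriv_smul (h.differentiableAt ha hz) (h.differentiableAt hξ.smooth hz),
    hξ.patchNormal_eq hz]

theorem patchNormalDeriv_hopfRe (hz : z ∈ Ω) (v : ℂ) :
    patchNormalDeriv c U v (hopfRe c U) z = patchNormalDeriv c U v (patchSecondForm c U 1 1) z -
      patchNormalDeriv c U v (patchSecondForm c U Complex.I Complex.I) z :=
  patchNormalDeriv_sub
    (h.differentiableAt (h.isPatchNormalField_patchSecondForm 1 1).smooth hz)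
    (h.differentiableAt (h.isPatchNormalField_patchSecondForm _ _).smooth hz) v

theorem patchNormalDeriv_hopfIm (hz : z ∈ Ω) (v : ℂ) :
    patchNormalDeriv c U v (hopfIm c U) z =
      (2 : ℝ) • patchNormalDeriv c U v (patchSecondForm c U 1 Complex.I) z := by
  exact (congrArg (patchNormal c U z) (dirDeriv_const_smul 2
    (h.differentiableAt (h.isPatchNormalField_patchSecondForm 1 Complex.I).smooth hz))).trans
      (map_smul _ _ _)

theorem eq_zero_of_ambForm_self_eq_zero (hξ : IsPatchNormalField c U Ω ξ) (hz : z ∈ Ω)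
    (h0 : ambForm c (ξ z) (ξ z) = 0) : ξ z = 0 :=
  (ambForm_self_eq_zero_iff_of_isTangentAt (h.mem z hz) (hξ.normal z hz).tangent).1 h0

end

end IsConformalPatch

namespace IsParallelFlatPatch

variable (h : IsParallelFlatPatch c U Ω)
include h

theorem patchNormalDeriv_fst_fst_add_snd_snd (hz : z ∈ Ω) (v : ℂ) :
    patchNormalDeriv c U v (patchSecondForm c U 1 1) z +
        patchNormalDeriv c U v (patchSecondForm c U Complex.I Complex.I) z =
      (2 * confLogDeriv c U v z) •
        (patchSecondForm c U 1 1 z + patchSecondForm c U Complex.I Complex.I z) := by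
  have hlam := h.contDiffOn_confFactor
  have hne : confFactor c U z ≠ 0 := h.norm_ne z hz
  rw [← patchNormalDeriv_add
      (h.differentiableAt (h.isPatchNormalField_patchSecondForm 1 1).smooth hz)
      (h.differentiableAt (h.isPatchNormalField_patchSecondForm _ _).smooth hz),
    patchNormalDeriv_congr h.isOpen (fun w hw => h.patchSecondForm_fst_fst_add_snd_snd hw) hz,
    h.patchNormalDeriv_smul_of_normal (contDiffOn_const.mul hlam)
      h.isPatchNormalField_patchMeanCurvature hz, h.parallel z hz, smul_zero, zero_add,
    h.patchSecondForm_fst_fst_add_snd_snd hz, smul_smul, confLogDeriv]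
  have hd : dirDeriv v (fun w => 2 * confFactor c U w) z = 2 * dirDeriv v (confFactor c U) z :=
    dirDeriv_const_smul 2 (h.differentiableAt hlam hz)
  rw [hd]
  congr 1
  field_simp

theorem patchNormalDeriv_fst_hopfIm (hz : z ∈ Ω) :
    patchNormalDeriv c U 1 (hopfIm c U) z = patchNormalDeriv c U Complex.I (hopfRe c U) z := by
  rw [h.patchNormalDeriv_hopfIm hz, h.patchNormalDeriv_hopfRe hz, h.codazzi_fst hz]
  linear_combination (norm := module) h.patchNormalDeriv_fst_fst_add_snd_snd hz Complex.I

theorem patchNormalDeriv_snd_hopfIm (hz : z ∈ Ω) :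
    patchNormalDeriv c U Complex.I (hopfIm c U) z = -patchNormalDeriv c U 1 (hopfRe c U) z := by
  rw [h.patchNormalDeriv_hopfIm hz, h.patchNormalDeriv_hopfRe hz, h.codazzi_snd hz]
  linear_combination (norm := module) h.patchNormalDeriv_fst_fst_add_snd_snd hz 1

theorem ambForm_hopfIm_smul_hopfRe (hξ : IsPatchNormalField c U Ω ξ) (hz : z ∈ Ω) :
    ambForm c (ξ z) (hopfIm c U z) • hopfRe c U z =
      ambForm c (ξ z) (hopfRe c U z) • hopfIm c U z := by
  have hric := h.ricci hξ hz
  rw [sub_eq_zero.2 (h.flat ξ hξ z hz), eq_comm, smul_eq_zero] at hric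
  exact sub_eq_zero.1
    (hric.resolve_left (inv_ne_zero (mul_ne_zero two_ne_zero (h.norm_ne z hz))))

theorem exists_smul_eq_hopf (hz : z ∈ Ω) :
    ∃ (ν : FlatAmbient n) (a b : ℝ), hopfRe c U z = a • ν ∧ hopfIm c U z = b • ν := by
  by_cases h0 : ambForm c (hopfIm c U z) (hopfIm c U z) = 0
  · exact ⟨hopfRe c U z, 1, 0, (one_smul _ _).symm, by
      rw [zero_smul, h.eq_zero_of_ambForm_self_eq_zero h.isPatchNormalField_hopfIm hz h0]⟩
  · have hα := inv_smul_smul₀ h0 (hopfRe c U z)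
    rw [h.ambForm_hopfIm_smul_hopfRe h.isPatchNormalField_hopfIm hz, smul_smul] at hα
    exact ⟨hopfIm c U z, _, 1, hα.symm, (one_smul _ _).symm⟩

theorem hopfRe_eq_zero_and_hopfIm_eq_zero (hz : z ∈ Ω) (hsum : ambForm c (hopfRe c U z)
    (hopfRe c U z) + ambForm c (hopfIm c U z) (hopfIm c U z) = 0) :
    hopfRe c U z = 0 ∧ hopfIm c U z = 0 := by
  have hα := h.isPatchNormalField_hopfRe
  have hγ := h.isPatchNormalField_hopfIm
  have hα₀ := ambForm_self_nonneg_of_isTangentAt (h.mem z hz) (hα.normal z hz).tangent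
  have hγ₀ := ambForm_self_nonneg_of_isTangentAt (h.mem z hz) (hγ.normal z hz).tangent
  exact ⟨h.eq_zero_of_ambForm_self_eq_zero hα hz (by linarith),
    h.eq_zero_of_ambForm_self_eq_zero hγ hz (by linarith)⟩

theorem hopfQuartic_eq_zero_iff (hz : z ∈ Ω) :
    hopfQuartic c U z = 0 ↔ hopfRe c U z = 0 ∧ hopfIm c U z = 0 := by
  refine ⟨fun h0 => ?_, fun ⟨hα, hγ⟩ => ?_⟩
  · have hnorm : ambForm c (hopfRe c U z) (hopfRe c U z) -
        ambForm c (hopfIm c U z) (hopfIm c U z) = 0 := congrArg Complex.re h0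
    have him : -2 * ambForm c (hopfRe c U z) (hopfIm c U z) = 0 := congrArg Complex.im h0
    have horth : ambForm c (hopfRe c U z) (hopfIm c U z) = 0 := by linarith
    have hprod := congrArg (ambForm c · (hopfRe c U z))
      (h.ambForm_hopfIm_smul_hopfRe h.isPatchNormalField_hopfIm hz)
    simp only [ambForm_smul_left] at hprod
    rw [ambForm_comm (hopfIm c U z) (hopfRe c U z), horth, zero_mul] at hprod
    apply h.hopfRe_eq_zero_and_hopfIm_eq_zero hz
    rcases mul_eq_zero.1 hprod with h0 | h0 <;> linarith
  · simp [hopfQuartic, hα, hγ, ambForm_zero_right, Complex.ext_iff]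

theorem differentiableOn_hopfQuartic : DifferentiableOn ℂ (hopfQuartic c U) Ω := by
  intro z hz
  have hα := h.isPatchNormalField_hopfRe
  have hγ := h.isPatchNormalField_hopfIm
  have hαα := h.differentiableAt (contDiffOn_ambForm (c := c) hα.smooth hα.smooth) hz
  have hαγ := h.differentiableAt (contDiffOn_ambForm (c := c) hα.smooth hγ.smooth) hz
  have hγγ := h.differentiableAt (contDiffOn_ambForm (c := c) hγ.smooth hγ.smooth) hz
  have hp (v : ℂ) := (dirDeriv_sub hαα hγγ (v := v)).trans
    (congrArg₂ (· - ·) (h.dirDeriv_ambForm_of_normal hα hα hz v)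
      (h.dirDeriv_ambForm_of_normal hγ hγ hz v))
  have hq (v : ℂ) := (dirDeriv_const_smul (-2) hαγ (v := v)).trans
    (congrArg _ (h.dirDeriv_ambForm_of_normal hα hγ hz v))
  simp only [ambForm_comm (patchNormalDeriv c U _ _ z)] at hp hq
  refine (differentiableAt_mk_of_cauchyRiemann (hαα.fun_sub hγγ)
    (hαγ.fun_const_smul (-2 : ℝ)) ?_ ?_).differentiableWithinAt
  · rw [hp, hq, ← h.patchNormalDeriv_fst_hopfIm hz, h.patchNormalDeriv_snd_hopfIm hz,
      ambForm_neg_right, smul_eq_mul]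
    ring
  · rw [hp, hq, ← h.patchNormalDeriv_fst_hopfIm hz, h.patchNormalDeriv_snd_hopfIm hz,
      ambForm_neg_right, smul_eq_mul]
    ring

end IsParallelFlatPatch

end ParallelFlat

/-! ### The linear system of a parallel flat patch -/

section LinearSystem

variable {n : ℕ}

/-- The fields `U, ∂₁U, ∂₂U, H, α, γ`, which solve a linear system wherever the Hopf differential
does not vanish.  The system reduces dimension because `α` and `γ` are parallel vectors. -/
noncomputable def patchFields (c : ℝ) (U : ℂ → FlatAmbient n) : Fin 6 → ℂ → FlatAmbient n :=
  ![U, ∂₁ U, ∂₂ U, patchMeanCurvature c U, hopfRe c U, hopfIm c U]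

variable {c : ℝ} {U : ℂ → FlatAmbient n} {Ω Ω' : Set ℂ} {z z₀ : ℂ} {f ξ η : ℂ → FlatAmbient n}
  {W : Submodule ℝ (FlatAmbient n)}

theorem patchNormalDeriv_eq_re_smul_add_im_smul (f : ℂ → FlatAmbient n) (v z : ℂ) :
    patchNormalDeriv c U v f z =
      v.re • patchNormalDeriv c U 1 f z + v.im • patchNormalDeriv c U Complex.I f z := by
  simp only [patchNormalDeriv, dirDeriv_eq_re_smul_add_im_smul f v, map_add, map_smul]

theorem contSpan_patchNormalDeriv_of_fst_of_snd {X : Fin 6 → ℂ → FlatAmbient n}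
    (h₁ : ContSpan X Ω (patchNormalDeriv c U 1 f))
    (h₂ : ContSpan X Ω (patchNormalDeriv c U Complex.I f)) (v : ℂ) :
    ContSpan X Ω (patchNormalDeriv c U v f) :=
  (ContSpan.add (.smul continuousOn_const h₁) (.smul continuousOn_const h₂)).congr
    fun z _ => patchNormalDeriv_eq_re_smul_add_im_smul f v z

theorem contSpan_patchSecondForm_fst_snd :
    ContSpan (patchFields c U) Ω' (patchSecondForm c U 1 Complex.I) :=
  (ContSpan.smul (a := fun _ => (2 : ℝ)⁻¹) continuousOn_const (.single 5)).congr
    fun _ _ => (inv_smul_smul₀ two_ne_zero _).symm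

theorem dirDeriv_mem_submodule (hop : IsOpen Ω) (hf : ContDiffOn ℝ ∞ f Ω)
    (hW : ∀ z ∈ Ω, f z ∈ W) (hz : z ∈ Ω) (v : ℂ) : dirDeriv v f z ∈ W := by
  have hline := (hasLineDerivAt_iff_tendsto_slope_zero.1
    ((differentiableAt_of_contDiffOn hop hf hz).hasFDerivAt.hasLineDerivAt v))
  have hmem : ∀ᶠ t : ℝ in 𝓝 0, z + t • v ∈ Ω :=
    Continuous.tendsto' (by fun_prop) 0 z (by simp) (hop.mem_nhds hz)
  exact W.closed_of_finiteDimensional.mem_of_tendsto hline <|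
    (hmem.filter_mono nhdsWithin_le_nhds).mono
      fun t ht => W.smul_mem _ (W.sub_mem (hW _ ht) (hW z hz))

theorem patchNormal_mem_submodule (hU : U z ∈ W) (hU₁ : ∂₁ U z ∈ W) (hU₂ : ∂₂ U z ∈ W)
    {X : FlatAmbient n} (hX : X ∈ W) : patchNormal c U z X ∈ W :=
  W.sub_mem (W.sub_mem (W.sub_mem hX (W.smul_mem _ hU)) (W.smul_mem _ hU₁)) (W.smul_mem _ hU₂)

namespace IsConformalPatch

variable (h : IsConformalPatch c U Ω)
include h

theorem contDiffOn_patchFields (i : Fin 6) : ContDiffOn ℝ ∞ (patchFields c U i) Ω := by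
  fin_cases i
  exacts [h.smooth, h.contDiffOn_dirDeriv 1, h.contDiffOn_dirDeriv _,
    h.isPatchNormalField_patchMeanCurvature.smooth, h.isPatchNormalField_hopfRe.smooth,
    h.isPatchNormalField_hopfIm.smooth]

theorem patchFields_mem_submodule (hW : ∀ z ∈ Ω, U z ∈ W) (hz : z ∈ Ω) (i : Fin 6) :
    patchFields c U i z ∈ W := by
  have hfst (v z : ℂ) (hz : z ∈ Ω) := dirDeriv_mem_submodule h.isOpen h.smooth hW hz v
  have hA (v w : ℂ) : patchSecondForm c U v w z ∈ W :=
    patchNormal_mem_submodule (hW z hz) (hfst 1 z hz) (hfst _ z hz)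
      (dirDeriv_mem_submodule h.isOpen (h.contDiffOn_dirDeriv w) (hfst w) hz v)
  fin_cases i
  exacts [hW z hz, hfst 1 z hz, hfst _ z hz, W.smul_mem _ (W.add_mem (hA _ _) (hA _ _)),
    W.sub_mem (hA _ _) (hA _ _), W.smul_mem _ (hA _ _)]

theorem mono (hop : IsOpen Ω') (hsub : Ω' ⊆ Ω) : IsConformalPatch c U Ω' :=
  ⟨hop, h.smooth.mono hsub, fun z hz => h.mem z (hsub hz), fun z hz => h.norm_eq z (hsub hz),
    fun z hz => h.orth z (hsub hz), fun z hz => h.norm_ne z (hsub hz)⟩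

theorem contSpan_dirDeriv (hsub : Ω' ⊆ Ω) (hf : ContDiffOn ℝ ∞ f Ω) (v : ℂ)
    (hN : ContSpan (patchFields c U) Ω' (patchNormalDeriv c U v f)) :
    ContSpan (patchFields c U) Ω' (dirDeriv v f) := by
  have hd := contDiffOn_dirDeriv h.isOpen hf v
  have hq := (h.contDiffOn_conormalForm hd).continuousOn.mono hsub
  have ht₁ := (h.contDiffOn_tangentCoeff_fst hd).continuousOn.mono hsub
  have ht₂ := (h.contDiffOn_tangentCoeff_snd hd).continuousOn.mono hsub
  refine (((hN.add (.smul hq (.single 0))).add (.smul ht₁ (.single 1))).add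
    (.smul ht₂ (.single 2))).congr fun z _ => ?_
  simp only [patchFields, Matrix.cons_val, patchNormalDeriv, patchNormal, normalProj_apply,
    tangentProj]
  module

theorem patchSecondForm_fst_fst (hz : z ∈ Ω) : patchSecondForm c U 1 1 z =
    confFactor c U z • patchMeanCurvature c U z + (1 / 2 : ℝ) • hopfRe c U z := by
  rw [hopfRe]
  linear_combination (norm := module) (1 / 2 : ℝ) • h.patchSecondForm_fst_fst_add_snd_snd hz

theorem patchSecondForm_snd_snd (hz : z ∈ Ω) : patchSecondForm c U Complex.I Complex.I z =
    confFactor c U z • patchMeanCurvature c U z + (-1 / 2 : ℝ) • hopfRe c U z := by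
  rw [hopfRe]
  linear_combination (norm := module) (1 / 2 : ℝ) • h.patchSecondForm_fst_fst_add_snd_snd hz

theorem contSpan_patchNormalDeriv_dirDeriv_fst (hsub : Ω' ⊆ Ω) (v : ℂ) :
    ContSpan (patchFields c U) Ω' (patchNormalDeriv c U v (∂₁ U)) := by
  have hlam := h.contDiffOn_confFactor.continuousOn.mono hsub
  refine contSpan_patchNormalDeriv_of_fst_of_snd ?_ ?_ v
  · exact (ContSpan.add (.smul hlam (.single 3)) (.smul continuousOn_const (.single 4))).congr
      fun z hz => h.patchSecondForm_fst_fst (hsub hz)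
  · exact contSpan_patchSecondForm_fst_snd.congr
      fun z hz => h.patchSecondForm_comm (hsub hz) Complex.I 1

theorem contSpan_patchNormalDeriv_dirDeriv_snd (hsub : Ω' ⊆ Ω) (v : ℂ) :
    ContSpan (patchFields c U) Ω' (patchNormalDeriv c U v (∂₂ U)) := by
  have hlam := h.contDiffOn_confFactor.continuousOn.mono hsub
  refine contSpan_patchNormalDeriv_of_fst_of_snd contSpan_patchSecondForm_fst_snd ?_ v
  exact (ContSpan.add (.smul hlam (.single 3)) (.smul continuousOn_const (.single 4))).congr
    fun z hz => h.patchSecondForm_snd_snd (hsub hz)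

theorem patchNormalDeriv_of_smul_eq_smul {a b : ℂ → ℝ} (ha : ContDiffOn ℝ ∞ a Ω)
    (hb : ContDiffOn ℝ ∞ b Ω) (hξ : IsPatchNormalField c U Ω ξ) (hη : IsPatchNormalField c U Ω η)
    (heq : ∀ w ∈ Ω, a w • ξ w = b w • η w) (hz : z ∈ Ω) (v : ℂ) :
    a z • patchNormalDeriv c U v ξ z + dirDeriv v a z • ξ z =
      b z • patchNormalDeriv c U v η z + dirDeriv v b z • η z := by
  rw [← h.patchNormalDeriv_smul_of_normal ha hξ hz, ← h.patchNormalDeriv_smul_of_normal hb hη hz,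
    patchNormalDeriv_congr h.isOpen heq hz]

end IsConformalPatch

namespace IsParallelFlatPatch

variable (h : IsParallelFlatPatch c U Ω)
include h

theorem contDiffOn_ambForm_hopfRe_self :
    ContDiffOn ℝ ∞ (fun w => ambForm c (hopfRe c U w) (hopfRe c U w)) Ω :=
  contDiffOn_ambForm h.isPatchNormalField_hopfRe.smooth h.isPatchNormalField_hopfRe.smooth

theorem contDiffOn_ambForm_hopfRe_hopfIm :
    ContDiffOn ℝ ∞ (fun w => ambForm c (hopfRe c U w) (hopfIm c U w)) Ω :=
  contDiffOn_ambForm h.isPatchNormalField_hopfRe.smooth h.isPatchNormalField_hopfIm.smooth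

theorem contDiffOn_ambForm_hopfIm_self :
    ContDiffOn ℝ ∞ (fun w => ambForm c (hopfIm c U w) (hopfIm c U w)) Ω :=
  contDiffOn_ambForm h.isPatchNormalField_hopfIm.smooth h.isPatchNormalField_hopfIm.smooth

theorem ambForm_hopfIm_self_smul_patchNormalDeriv (hz : z ∈ Ω) (v : ℂ) :
    ambForm c (hopfIm c U z) (hopfIm c U z) • patchNormalDeriv c U v (hopfRe c U) z
        + dirDeriv v (fun w => ambForm c (hopfIm c U w) (hopfIm c U w)) z • hopfRe c U z =
      ambForm c (hopfRe c U z) (hopfIm c U z) • patchNormalDeriv c U v (hopfIm c U) z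
        + dirDeriv v (fun w => ambForm c (hopfRe c U w) (hopfIm c U w)) z • hopfIm c U z := by
  refine h.patchNormalDeriv_of_smul_eq_smul h.contDiffOn_ambForm_hopfIm_self
    h.contDiffOn_ambForm_hopfRe_hopfIm h.isPatchNormalField_hopfRe h.isPatchNormalField_hopfIm
    (fun w hw => ?_) hz v
  rw [h.ambForm_hopfIm_smul_hopfRe h.isPatchNormalField_hopfIm hw, ambForm_comm]

theorem ambForm_hopfRe_self_smul_patchNormalDeriv (hz : z ∈ Ω) (v : ℂ) :
    ambForm c (hopfRe c U z) (hopfRe c U z) • patchNormalDeriv c U v (hopfIm c U) z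
        + dirDeriv v (fun w => ambForm c (hopfRe c U w) (hopfRe c U w)) z • hopfIm c U z =
      ambForm c (hopfRe c U z) (hopfIm c U z) • patchNormalDeriv c U v (hopfRe c U) z
        + dirDeriv v (fun w => ambForm c (hopfRe c U w) (hopfIm c U w)) z • hopfRe c U z :=
  h.patchNormalDeriv_of_smul_eq_smul h.contDiffOn_ambForm_hopfRe_self
    h.contDiffOn_ambForm_hopfRe_hopfIm h.isPatchNormalField_hopfIm h.isPatchNormalField_hopfRe
    (fun _ hw => (h.ambForm_hopfIm_smul_hopfRe h.isPatchNormalField_hopfRe hw).symm) hz v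

theorem contSpan_patchNormalDeriv_fst_hopf (hsub : Ω' ⊆ Ω)
    (hne : ∀ z ∈ Ω', hopfQuartic c U z ≠ 0) :
    ContSpan (patchFields c U) Ω' (patchNormalDeriv c U 1 (hopfRe c U)) ∧
      ContSpan (patchFields c U) Ω' (patchNormalDeriv c U 1 (hopfIm c U)) := by
  have hsum (z : ℂ) (hz : z ∈ Ω') : ambForm c (hopfRe c U z) (hopfRe c U z) +
      ambForm c (hopfIm c U z) (hopfIm c U z) ≠ 0 := fun h0 => hne z hz
    ((h.hopfQuartic_eq_zero_iff (hsub hz)).2 (h.hopfRe_eq_zero_and_hopfIm_eq_zero (hsub hz) h0))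
  have hinv := ((h.contDiffOn_ambForm_hopfRe_self.add
    h.contDiffOn_ambForm_hopfIm_self).continuousOn.mono hsub).inv₀ hsum
  have hcont {p : ℂ → ℝ} (hp : ContDiffOn ℝ ∞ p Ω) (v : ℂ) : ContinuousOn (dirDeriv v p) Ω' :=
    (contDiffOn_dirDeriv h.isOpen hp v).continuousOn.mono hsub
  have hαα := hcont h.contDiffOn_ambForm_hopfRe_self
  have hαγ := hcont h.contDiffOn_ambForm_hopfRe_hopfIm
  have hγγ := hcont h.contDiffOn_ambForm_hopfIm_self
  -- Differentiate `|γ|² α = ⟨α, γ⟩ γ` in one coordinate direction and `|α|² γ = ⟨α, γ⟩ α` in the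
  -- other.  After eliminating `∇₂` by Codazzi the terms with factor `⟨α, γ⟩` cancel.
  constructor
  · refine (ContSpan.smul hinv (.add (.smul ((hαγ 1).add (hαα Complex.I)) (.single 5))
      (.smul ((hγγ 1).neg.sub (hαγ Complex.I)) (.single 4)))).congr fun z hz => ?_
    rw [Pi.inv_apply, eq_inv_smul_iff₀ (hsum z hz)]
    have h₁ := h.ambForm_hopfIm_self_smul_patchNormalDeriv (hsub hz) 1
    have h₂ := h.ambForm_hopfRe_self_smul_patchNormalDeriv (hsub hz) Complex.I
    rw [h.patchNormalDeriv_snd_hopfIm (hsub hz), ← h.patchNormalDeriv_fst_hopfIm (hsub hz)] at h₂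
    simp only [patchFields, Matrix.cons_val, Pi.add_apply, Pi.sub_apply, Pi.neg_apply]
    linear_combination (norm := module) h₁ - h₂
  · refine (ContSpan.smul hinv (.add (.smul ((hαγ Complex.I).sub (hαα 1)) (.single 5))
      (.smul ((hαγ 1).sub (hγγ Complex.I)) (.single 4)))).congr fun z hz => ?_
    rw [Pi.inv_apply, eq_inv_smul_iff₀ (hsum z hz)]
    have h₁ := h.ambForm_hopfIm_self_smul_patchNormalDeriv (hsub hz) Complex.I
    have h₂ := h.ambForm_hopfRe_self_smul_patchNormalDeriv (hsub hz) 1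
    rw [h.patchNormalDeriv_snd_hopfIm (hsub hz), ← h.patchNormalDeriv_fst_hopfIm (hsub hz)] at h₁
    simp only [patchFields, Matrix.cons_val, Pi.sub_apply]
    linear_combination (norm := module) h₁ + h₂

theorem contSpan_patchNormalDeriv_fst_hopf_of_eq_zero (hop : IsOpen Ω') (hsub : Ω' ⊆ Ω)
    (h0 : ∀ z ∈ Ω', hopfQuartic c U z = 0) :
    ContSpan (patchFields c U) Ω' (patchNormalDeriv c U 1 (hopfRe c U)) ∧
      ContSpan (patchFields c U) Ω' (patchNormalDeriv c U 1 (hopfIm c U)) := by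
  have hzero {f : ℂ → FlatAmbient n} (hf : ∀ z ∈ Ω', f z = 0) :
      ContSpan (patchFields c U) Ω' (patchNormalDeriv c U 1 f) :=
    ContSpan.zero.congr fun z hz => by
      rw [patchNormalDeriv, dirDeriv_congr hop hf hz, dirDeriv_const, map_zero]
  exact ⟨hzero fun z hz => ((h.hopfQuartic_eq_zero_iff (hsub hz)).1 (h0 z hz)).1,
    hzero fun z hz => ((h.hopfQuartic_eq_zero_iff (hsub hz)).1 (h0 z hz)).2⟩

theorem contSpan_patchNormalDeriv_patchFields (hsub : Ω' ⊆ Ω)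
    (hα : ContSpan (patchFields c U) Ω' (patchNormalDeriv c U 1 (hopfRe c U)))
    (hγ : ContSpan (patchFields c U) Ω' (patchNormalDeriv c U 1 (hopfIm c U))) (i : Fin 6)
    (v : ℂ) : ContSpan (patchFields c U) Ω' (patchNormalDeriv c U v (patchFields c U i)) := by
  fin_cases i
  · exact ContSpan.zero.congr fun z hz => h.patchNormalDeriv_self (hsub hz) v
  · exact h.contSpan_patchNormalDeriv_dirDeriv_fst hsub v
  · exact h.contSpan_patchNormalDeriv_dirDeriv_snd hsub v
  · exact ContSpan.zero.congr fun z hz => h.parallel z (hsub hz) v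
  · exact contSpan_patchNormalDeriv_of_fst_of_snd hα
      (hγ.congr fun z hz => (h.patchNormalDeriv_fst_hopfIm (hsub hz)).symm) v
  · exact contSpan_patchNormalDeriv_of_fst_of_snd hγ
      ((ContSpan.smul (a := fun _ => -1) continuousOn_const hα).congr fun z hz => by
        rw [h.patchNormalDeriv_snd_hopfIm (hsub hz), neg_one_smul]) v

theorem solvesLinearSystem_patchFields (hsub : Ω' ⊆ Ω)
    (hφ : ContSpan (patchFields c U) Ω' (patchNormalDeriv c U 1 (hopfRe c U)) ∧
      ContSpan (patchFields c U) Ω' (patchNormalDeriv c U 1 (hopfIm c U))) :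
    SolvesLinearSystem (patchFields c U) Ω' where
  differentiableOn i := ((h.contDiffOn_patchFields i).mono hsub).differentiableOn (by simp)
  contSpan_fderiv i v := h.contSpan_dirDeriv hsub (h.contDiffOn_patchFields i) v
    (h.contSpan_patchNormalDeriv_patchFields hsub hφ.1 hφ.2 i v)

theorem exists_countable_solvesLinearSystem (hΩ : IsPreconnected Ω) :
    ∃ C : Set ℂ, C.Countable ∧ IsOpen (Ω \ C) ∧
      SolvesLinearSystem (patchFields c U) (Ω \ C) := by
  have hhol := h.differentiableOn_hopfQuartic
  by_cases hq : Set.EqOn (hopfQuartic c U) 0 Ω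
  · refine ⟨∅, Set.countable_empty, ?_⟩
    rw [Set.sdiff_empty]
    exact ⟨h.isOpen, h.solvesLinearSystem_patchFields le_rfl
      (h.contSpan_patchNormalDeriv_fst_hopf_of_eq_zero h.isOpen le_rfl hq)⟩
  · refine ⟨_, countable_zeros_of_differentiableOn h.isOpen hΩ hhol hq, ?_⟩
    rw [Set.sdiff_self_inter]
    refine ⟨hhol.continuousOn.isOpen_inter_preimage h.isOpen isOpen_compl_singleton,
      h.solvesLinearSystem_patchFields Set.sdiff_subset
        (h.contSpan_patchNormalDeriv_fst_hopf Set.sdiff_subset fun z hz => hz.2)⟩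

theorem exists_countable_forall_mem_submodule (hΩ : IsPreconnected Ω) :
    ∃ C : Set ℂ, C.Countable ∧ ∀ W : Submodule ℝ (FlatAmbient n), ∀ z₀ ∈ Ω \ C,
      (∀ i, patchFields c U i z₀ ∈ W) → ∀ z ∈ Ω, U z ∈ W := by
  obtain ⟨C, hC, hop, hX⟩ := h.exists_countable_solvesLinearSystem hΩ
  refine ⟨C, hC, fun W z₀ hz₀ h0 z hz => ?_⟩
  have hW : IsClosed (W : Set (FlatAmbient n)) := W.closed_of_finiteDimensional
  have hpre : IsPreconnected (Ω \ C) := isPreconnected_diff_countable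
    (by rw [Complex.rank_real_complex]; norm_num) h.isOpen hΩ hC
  have hz' : z ∈ closure (Ω \ C) := (hC.dense_compl ℝ).open_subset_closure_inter h.isOpen hz
  exact hW.closure_subset ((h.smooth.continuousOn.continuousAt
    (h.isOpen.mem_nhds hz)).continuousWithinAt.mem_closure hz'
      fun w hw => hX.mem_submodule hop hpre hW hz₀ h0 hw 0)

theorem mem_submodule_of_open_subset (hΩ : IsPreconnected Ω) {V : Set ℂ} (hV : IsOpen V)
    (hne : V.Nonempty) (hsub : V ⊆ Ω) (hW : ∀ z ∈ V, U z ∈ W) (hz : z ∈ Ω) : U z ∈ W := by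
  obtain ⟨C, hC, hmem⟩ := h.exists_countable_forall_mem_submodule hΩ
  obtain ⟨z₀, hz₀, hzC⟩ := (hC.dense_compl ℝ).inter_open_nonempty V hV hne
  exact hmem W z₀ ⟨hsub hz₀, hzC⟩ ((h.mono hV hsub).patchFields_mem_submodule hW hz₀) z hz

theorem exists_submodule_finrank_le_five (hΩ : IsPreconnected Ω) (hne : Ω.Nonempty) :
    ∃ W : Submodule ℝ (FlatAmbient n), Module.finrank ℝ W ≤ 5 ∧ ∀ z ∈ Ω, U z ∈ W := by
  obtain ⟨C, hC, hmem⟩ := h.exists_countable_forall_mem_submodule hΩ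
  obtain ⟨z₀, hz₀, hzC⟩ := (hC.dense_compl ℝ).inter_open_nonempty Ω h.isOpen hne
  obtain ⟨ν, a, b, hα, hγ⟩ := h.exists_smul_eq_hopf hz₀
  let Y : Fin 5 → FlatAmbient n := ![U z₀, ∂₁ U z₀, ∂₂ U z₀, patchMeanCurvature c U z₀, ν]
  have hY (j : Fin 5) : Y j ∈ Submodule.span ℝ (Set.range Y) :=
    Submodule.subset_span (Set.mem_range_self j)
  refine ⟨Submodule.span ℝ (Set.range Y), finrank_range_le_card Y,
    hmem _ z₀ ⟨hz₀, hzC⟩ fun i => ?_⟩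
  have hα' : hopfRe c U z₀ ∈ Submodule.span ℝ (Set.range Y) := by
    rw [hα]; exact Submodule.smul_mem _ a (hY 4)
  have hγ' : hopfIm c U z₀ ∈ Submodule.span ℝ (Set.range Y) := by
    rw [hγ]; exact Submodule.smul_mem _ b (hY 4)
  fin_cases i
  exacts [hY 0, hY 1, hY 2, hY 3, hα', hγ']

end IsParallelFlatPatch

end LinearSystem

/-! ### Totally geodesic space forms -/

section TotallyGeodesic

variable {m n : ℕ} {c : ℝ}

theorem mem_spaceForm_iff {x : FlatAmbient n} :
    x ∈ spaceForm n c ↔ conormalForm c x x = 1 ∧ (c ≤ 0 → 0 < x.1) := by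
  rw [spaceForm, Set.mem_ofPred_eq, conormalForm, real_inner_self_eq_norm_sq, sq]

theorem fst_pos_iff_conormalForm_pos {x y : FlatAmbient n} (hc : c ≤ 0) (hx : x ∈ spaceForm n c)
    (hy : conormalForm c y y = 1) : 0 < y.1 ↔ 0 < conormalForm c x y := by
  have hxx : c * ‖x.2‖ ^ 2 = 1 - x.1 ^ 2 := by linarith [hx.1]
  have hyy : c * ‖y.2‖ ^ 2 = 1 - y.1 ^ 2 := by
    rw [conormalForm, real_inner_self_eq_norm_sq] at hy
    linarith
  have hx2 : c * ‖x.2‖ ^ 2 ≤ 0 := mul_nonpos_of_nonpos_of_nonneg hc (sq_nonneg _)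
  have hy2 : c * ‖y.2‖ ^ 2 ≤ 0 := mul_nonpos_of_nonpos_of_nonneg hc (sq_nonneg _)
  -- The reversed Cauchy–Schwarz inequality for timelike vectors.
  have hlt : (c * inner ℝ x.2 y.2) ^ 2 < (x.1 * y.1) ^ 2 := by
    refine (mul_inner_sq_le c x.2 y.2).trans_lt ?_
    rw [hxx, hyy] at *
    nlinarith
  have habs := sq_lt_sq.1 hlt
  rw [conormalForm, ← mul_pos_iff_of_pos_left (hx.2 hc)]
  constructor <;> intro hpos
  · rw [abs_of_pos hpos] at habs
    linarith [neg_abs_le (c * inner ℝ x.2 y.2)]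
  · by_contra! hnonpos
    rw [abs_of_nonpos hnonpos] at habs
    linarith [le_abs_self (c * inner ℝ x.2 y.2)]

/-- The linear map `(t, y) ↦ t x + ∑ yᵢ bᵢ`.  If `b` is an orthonormal family tangent to the space
form at `x`, it parametrises the totally geodesic space form through `x` in the directions `b`. -/
noncomputable def frameMap (x : FlatAmbient n) (b : Fin m → FlatAmbient n) :
    FlatAmbient m →L[ℝ] FlatAmbient n :=
  (ContinuousLinearMap.fst ℝ ℝ (EuclideanSpace ℝ (Fin m))).smulRight x +
    ∑ i, ((EuclideanSpace.proj i).comp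
      (ContinuousLinearMap.snd ℝ ℝ (EuclideanSpace ℝ (Fin m)))).smulRight (b i)

theorem frameMap_apply (x : FlatAmbient n) (b : Fin m → FlatAmbient n) (p : FlatAmbient m) :
    frameMap x b p = p.1 • x + ∑ i, p.2 i • b i := by
  simp [frameMap]

/-- A family of vectors `b` tangent to the space form at its point `x` and orthonormal for the flat
form. -/
structure IsOrthonormalTangentFrame (c : ℝ) (x : FlatAmbient n) (b : Fin m → FlatAmbient n) :
    Prop where
  mem : x ∈ spaceForm n c
  tangent : ∀ i, IsTangentAt c x (b i)
  ambForm_eq : ∀ i j, ambForm c (b i) (b j) = if i = j then 1 else 0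

namespace IsOrthonormalTangentFrame

variable {x : FlatAmbient n} {b : Fin m → FlatAmbient n} (h : IsOrthonormalTangentFrame c x b)
include h

theorem ambForm_sum (y y' : EuclideanSpace ℝ (Fin m)) :
    ambForm c (∑ i, y i • b i) (∑ i, y' i • b i) = inner ℝ y y' := by
  have hij (i j : Fin m) : diagForm n c⁻¹ 1 (b i) (b j) = if i = j then 1 else 0 := by
    rw [← ambForm_eq_diagForm, h.ambForm_eq]
  rw [ambForm_eq_diagForm, map_sum, PiLp.inner_apply]
  refine Finset.sum_congr rfl fun j _ => ?_
  rw [map_smul, map_sum, sum_apply, Finset.sum_eq_single j (fun i _ hi => ?_) (by simp)]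
  · simp [hij, mul_comm]
  · rw [map_smul, smul_apply, hij, if_neg hi, smul_zero]

theorem isTangentAt_sum (y : EuclideanSpace ℝ (Fin m)) : IsTangentAt c x (∑ i, y i • b i) := by
  have hi (i : Fin m) : diagForm n 1 c x (b i) = 0 := by
    rw [← conormalForm_eq_diagForm]
    exact h.tangent i
  simp only [IsTangentAt, conormalForm_eq_diagForm, map_sum, map_smul, hi, smul_zero,
    Finset.sum_const_zero]

theorem conormalForm_point_frameMap (p : FlatAmbient m) :
    conormalForm c x (frameMap x b p) = p.1 := by
  rw [frameMap_apply, conormalForm_add_right, conormalForm_smul_right, conormalForm_self h.mem,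
    h.isTangentAt_sum, mul_one, add_zero]

theorem conormalForm_frameMap (p q : FlatAmbient m) :
    conormalForm c (frameMap x b p) (frameMap x b q) = conormalForm c p q := by
  have hp := h.isTangentAt_sum p.2
  rw [conormalForm_comm, frameMap_apply x b p, conormalForm_add_right, conormalForm_smul_right,
    conormalForm_comm _ x, h.conormalForm_point_frameMap, frameMap_apply, conormalForm_comm,
    conormalForm_add_right, conormalForm_smul_right, conormalForm_comm _ x, hp,
    conormalForm_of_isTangentAt h.mem hp, h.ambForm_sum, conormalForm]
  ring

theorem ambForm_frameMap {p v w : FlatAmbient m} (hp : p ∈ spaceForm m c)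
    (hv : IsTangentAt c p v) (hw : IsTangentAt c p w) :
    ambForm c (frameMap x b v) (frameMap x b w) = ambForm c v w := by
  by_cases hc : c = 0
  · subst hc
    rw [frameMap_apply, frameMap_apply, fst_eq_zero_of_isTangentAt hp hv,
      fst_eq_zero_of_isTangentAt hp hw, zero_smul, zero_add, zero_add, h.ambForm_sum, ambForm,
      inv_zero, zero_mul, zero_add]
  · have hform := h.conormalForm_frameMap v w
    rw [conormalForm_eq_mul_ambForm hc, conormalForm_eq_mul_ambForm hc] at hform
    exact mul_left_cancel₀ hc hform

theorem frameMap_injective : Function.Injective (frameMap x b) := by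
  refine (injective_iff_map_eq_zero _).2 fun p hp => ?_
  have hp1 : p.1 = 0 := by
    rw [← h.conormalForm_point_frameMap p, hp, conormalForm_eq_diagForm, map_zero]
  rw [frameMap_apply, hp1, zero_smul, zero_add] at hp
  have hp2 := h.ambForm_sum p.2 p.2
  rw [hp, ambForm_zero_right] at hp2
  exact Prod.ext hp1 (inner_self_eq_zero.1 hp2.symm)

theorem frameMap_mem_spaceForm_iff {p : FlatAmbient m} :
    frameMap x b p ∈ spaceForm n c ↔ p ∈ spaceForm m c := by
  rw [mem_spaceForm_iff, mem_spaceForm_iff, h.conormalForm_frameMap]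
  refine and_congr_right fun hp => forall_congr' fun hc => ?_
  rw [fst_pos_iff_conormalForm_pos hc h.mem ((h.conormalForm_frameMap p p).trans hp),
    h.conormalForm_point_frameMap]

theorem isSpaceFormGeodesic_frameMap_comp {γ : ℝ → FlatAmbient m}
    (hγ : IsSpaceFormGeodesic m c γ) : IsSpaceFormGeodesic n c (frameMap x b ∘ γ) := by
  have hderiv {f : ℝ → FlatAmbient m} (hf : ContDiff ℝ ∞ f) :
      deriv (frameMap x b ∘ f) = frameMap x b ∘ deriv f :=
    funext fun t => ((frameMap x b).hasFDerivAt.comp_hasDerivAt t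
      (hf.differentiable (by simp) t).hasDerivAt).deriv
  refine ⟨(frameMap x b).contDiff.comp hγ.smooth,
    fun t => h.frameMap_mem_spaceForm_iff.2 (hγ.mem t), fun t => ?_⟩
  have haccel := congrArg (frameMap x b) (hγ.accel t)
  rw [tangentProj, map_sub, map_smul, map_zero] at haccel
  rw [hderiv hγ.smooth, hderiv (contDiff_infty_iff_deriv.1 hγ.smooth).2, tangentProj,
    Function.comp_apply, Function.comp_apply, h.conormalForm_frameMap, haccel]

theorem isTotallyGeodesicSpaceForm_image :
    IsTotallyGeodesicSpaceForm m n c (frameMap x b '' spaceForm m c) := by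
  refine ⟨frameMap x b, (frameMap x b).contDiff, fun p => h.frameMap_mem_spaceForm_iff.2, ?_, ?_,
    fun γ => h.isSpaceFormGeodesic_frameMap_comp, rfl⟩
  · exact (LinearMap.isClosedEmbedding_of_injective
      (f := (frameMap x b : FlatAmbient m →ₗ[ℝ] FlatAmbient n))
      (LinearMap.ker_eq_bot.2 h.frameMap_injective)).isEmbedding.comp .subtypeVal
  · intro p hp v w hv hw
    rw [ContinuousLinearMap.fderiv]
    exact h.ambForm_frameMap hp hv hw

theorem mem_image_of_mem_span {y : FlatAmbient n} (hy : y ∈ spaceForm n c)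
    (hspan : y - conormalForm c x y • x ∈ Submodule.span ℝ (Set.range b)) :
    y ∈ frameMap x b '' spaceForm m c := by
  obtain ⟨a, ha⟩ := (Submodule.mem_span_range_iff_exists_fun ℝ).1 hspan
  have hya : frameMap x b (conormalForm c x y, WithLp.toLp 2 a) = y := by
    rw [frameMap_apply, ha, add_sub_cancel]
  exact ⟨_, h.frameMap_mem_spaceForm_iff.1 (hya.symm ▸ hy), hya⟩

end IsOrthonormalTangentFrame

/-- The tangent space of the space form at `x`. -/
noncomputable def tangentSubmodule (c : ℝ) (x : FlatAmbient n) : Submodule ℝ (FlatAmbient n) :=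
  LinearMap.ker (diagForm n 1 c x : FlatAmbient n →ₗ[ℝ] ℝ)

theorem mem_tangentSubmodule {x v : FlatAmbient n} :
    v ∈ tangentSubmodule c x ↔ IsTangentAt c x v := by
  rw [tangentSubmodule, LinearMap.mem_ker, IsTangentAt, conormalForm_eq_diagForm,
    ContinuousLinearMap.coe_coe]

theorem le_finrank_tangentSubmodule (x : FlatAmbient n) :
    n ≤ Module.finrank ℝ (tangentSubmodule c x) := by
  have hrank := LinearMap.finrank_range_add_finrank_ker (diagForm n 1 c x : FlatAmbient n →ₗ[ℝ] ℝ)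
  have hrange := Submodule.finrank_le
    (LinearMap.range (diagForm n 1 c x : FlatAmbient n →ₗ[ℝ] ℝ))
  rw [Module.finrank_self] at hrange
  rw [Module.finrank_prod, Module.finrank_self, finrank_euclideanSpace_fin] at hrank
  rw [tangentSubmodule]
  omega

theorem exists_submodule_between_finrank_eq {K V : Type*} [DivisionRing K] [AddCommGroup V]
    [Module K V] [FiniteDimensional K V] {S T : Submodule K V} (hST : S ≤ T) {k : ℕ}
    (hS : Module.finrank K S ≤ k) (hT : k ≤ Module.finrank K T) :
    ∃ R : Submodule K V, S ≤ R ∧ R ≤ T ∧ Module.finrank K R = k := by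
  induction k, hS using Nat.le_induction with
  | base => exact ⟨S, le_rfl, hST, rfl⟩
  | succ k _ ih =>
    obtain ⟨R, hSR, hRT, hR⟩ := ih (by omega)
    have hlt : R < T := lt_of_le_of_ne hRT fun h => by subst h; omega
    obtain ⟨v, hvT, hvR⟩ := SetLike.exists_of_lt hlt
    have hv0 : v ≠ 0 := fun h => hvR (h ▸ R.zero_mem)
    refine ⟨R ⊔ K ∙ v, hSR.trans le_sup_left,
      sup_le hRT ((Submodule.span_singleton_le_iff_mem v T).2 hvT), ?_⟩
    have hsup := Submodule.finrank_sup_add_finrank_inf_eq R (K ∙ v)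
    rw [(Submodule.disjoint_span_singleton' hv0).2 hvR |>.eq_bot, finrank_bot,
      finrank_span_singleton hv0, hR] at hsup
    omega

theorem exists_orthonormal_basis_of_le_tangentSubmodule {x : FlatAmbient n}
    (hx : x ∈ spaceForm n c) {T : Submodule ℝ (FlatAmbient n)} (hT : T ≤ tangentSubmodule c x) :
    ∃ v : Module.Basis (Fin (Module.finrank ℝ T)) ℝ T,
      ∀ i j, ambForm c (v i : FlatAmbient n) (v j) = if i = j then 1 else 0 := by
  let B : LinearMap.BilinForm ℝ T :=
    LinearMap.mk₂ ℝ (fun v w => ambForm c (v : FlatAmbient n) w) (fun _ _ _ => ambForm_add_left ..)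
      (fun _ _ _ => ambForm_smul_left ..) (fun _ _ _ => ambForm_add_right ..)
      (fun _ _ _ => ambForm_smul_right ..)
  obtain ⟨v, hv⟩ := LinearMap.BilinForm.exists_orthogonal_basis (B := B)
    ⟨fun v w => ambForm_comm (v : FlatAmbient n) w⟩
  have hpos (i) : 0 < ambForm c (v i : FlatAmbient n) (v i) :=
    ambForm_self_pos_of_isTangentAt hx (mem_tangentSubmodule.1 (hT (v i).2))
      fun h0 => v.ne_zero i (Subtype.ext h0)
  refine ⟨v.isUnitSMul (w := fun i => (√(ambForm c (v i : FlatAmbient n) (v i)))⁻¹)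
    fun i => (inv_ne_zero (Real.sqrt_ne_zero'.2 (hpos i))).isUnit, fun i j => ?_⟩
  rw [Module.Basis.isUnitSMul_apply, Module.Basis.isUnitSMul_apply, Submodule.coe_smul,
    Submodule.coe_smul, ambForm_smul_left, ambForm_smul_right]
  split_ifs with hij
  · subst hij
    rw [← mul_assoc, ← mul_inv, Real.mul_self_sqrt (hpos i).le, inv_mul_cancel₀ (hpos i).ne']
  · have horth : ambForm c (v i : FlatAmbient n) (v j) = 0 := hv hij
    rw [horth, mul_zero, mul_zero]

theorem exists_isOrthonormalTangentFrame_span_eq {x : FlatAmbient n} (hx : x ∈ spaceForm n c)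
    {T : Submodule ℝ (FlatAmbient n)} (hT : T ≤ tangentSubmodule c x)
    (hm : Module.finrank ℝ T = m) :
    ∃ b : Fin m → FlatAmbient n,
      IsOrthonormalTangentFrame c x b ∧ Submodule.span ℝ (Set.range b) = T := by
  subst hm
  obtain ⟨v, hv⟩ := exists_orthonormal_basis_of_le_tangentSubmodule hx hT
  refine ⟨fun i => v i, ⟨hx, fun i => mem_tangentSubmodule.1 (hT (v i).2), hv⟩, ?_⟩
  rw [Set.range_comp' Subtype.val v, ← T.coe_subtype, Submodule.span_image, v.span_eq,
    Submodule.map_subtype_top]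

theorem exists_isTotallyGeodesicSpaceForm_of_finrank_le {x : FlatAmbient n}
    (hx : x ∈ spaceForm n c) {W : Submodule ℝ (FlatAmbient n)} (hxW : x ∈ W) (hm : m ≤ n)
    (hW : Module.finrank ℝ W ≤ m + 1) :
    ∃ P : Set (FlatAmbient n), IsTotallyGeodesicSpaceForm m n c P ∧
      spaceForm n c ∩ W ⊆ P := by
  have hxT : x ∉ tangentSubmodule c x := by
    rw [mem_tangentSubmodule, IsTangentAt, conormalForm_self hx]
    exact one_ne_zero
  have hlt : W ⊓ tangentSubmodule c x < W :=
    inf_lt_left.2 fun h => hxT (h hxW)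
  obtain ⟨R, hSR, hRT, hR⟩ := exists_submodule_between_finrank_eq inf_le_right
    (Nat.lt_succ_iff.1 ((Submodule.finrank_lt_finrank_of_lt hlt).trans_le hW))
    (hm.trans (le_finrank_tangentSubmodule x))
  obtain ⟨b, hb, hspan⟩ := exists_isOrthonormalTangentFrame_span_eq hx hRT hR
  refine ⟨_, hb.isTotallyGeodesicSpaceForm_image, fun y ⟨hy, hyW⟩ => ?_⟩
  refine hb.mem_image_of_mem_span hy (hspan ▸ hSR ⟨W.sub_mem hyW (W.smul_mem _ hxW), ?_⟩)
  rw [SetLike.mem_coe, mem_tangentSubmodule, IsTangentAt, conormalForm_sub_right,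
    conormalForm_smul_right, conormalForm_self hx, mul_one, sub_self]

end TotallyGeodesic

/-! ### Coordinate charts of the surface -/

section ExtendedChart

variable {𝕜 E H M : Type*} [NontriviallyNormedField 𝕜] [NormedAddCommGroup E] [NormedSpace 𝕜 E]
  [TopologicalSpace H] {I : ModelWithCorners 𝕜 E H} [TopologicalSpace M]
  {e : OpenPartialHomeomorph M H} {Ω : Set E} {p : M}

theorem isOpen_image_extend_symm (hop : IsOpen Ω) (ht : Ω ⊆ (e.extend I).target) :
    IsOpen ((e.extend I).symm '' Ω) := by
  rw [(e.extend I).symm.image_eq_target_inter_inv_preimage ht]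
  exact e.isOpen_extend_preimage' hop

theorem closure_image_extend_symm_mem_nhds (hp : p ∈ e.source)
    (hΩ : closure Ω ∈ 𝓝[Set.range I] (e.extend I p)) :
    closure ((e.extend I).symm '' Ω) ∈ 𝓝 p := by
  rw [← e.map_extend_nhds hp, Filter.mem_map] at hΩ
  filter_upwards [hΩ, e.open_source.mem_nhds hp] with q hqΩ hq
  have hmem := (e.continuousAt_extend_symm (I := I) hq).continuousWithinAt.mem_closure_image hqΩ
  rwa [e.extend_left_inv hq] at hmem

theorem countable_inter_preimage_of_isDiscrete {X Y : Type*} [TopologicalSpace X]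
    [TopologicalSpace Y] [SecondCountableTopology X] {f : X → Y} {s : Set X} {B : Set Y}
    (hf : ContinuousOn f s) (hinj : Set.InjOn f s) (hB : IsDiscrete B) :
    (s ∩ f ⁻¹' B).Countable := by
  have := hB.to_subtype
  have hmaps : Set.MapsTo f (s ∩ f ⁻¹' B) B := fun _ hx => hx.2
  have : DiscreteTopology ↥(s ∩ f ⁻¹' B) := DiscreteTopology.of_continuous_injective
    ((hf.mono Set.inter_subset_left).mapsToRestrict hmaps)
    (hmaps.restrict_inj.2 (hinj.mono Set.inter_subset_left))
  exact (HereditarilyLindelofSpace.isLindelof _).countable this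

end ExtendedChart

section HalfPlane

theorem range_halfPlaneModel : Set.range halfPlaneModel = {z : ℂ | 0 ≤ z.im} :=
  range_closedHalfPlane_val

theorem uniqueDiffOn_closedHalfPlane : UniqueDiffOn ℝ {z : ℂ | 0 ≤ z.im} := by
  refine uniqueDiffOn_convex (convex_halfSpace_im_ge 0) ⟨Complex.I, ?_⟩
  rw [Complex.interior_setOfPred_le_im]
  simp

end HalfPlane

section Charts

variable {S : Type*} [TopologicalSpace S] {n : ℕ} {c : ℝ} {u : S → FlatAmbient n}
  {e e' : OpenPartialHomeomorph S ClosedHalfPlane} {Ω : Set ℂ} {z : ℂ} {p : S}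
  {F : Type*} [NormedAddCommGroup F] [NormedSpace ℝ F] {g : S → F}

theorem exists_isPreconnected_subset_extend_target (hp : p ∈ e.source) :
    ∃ Ω : Set ℂ, IsOpen Ω ∧ IsPreconnected Ω ∧ Ω ⊆ (e.extend halfPlaneModel).target ∧
      closure Ω ∈ 𝓝[Set.range halfPlaneModel] (e.extend halfPlaneModel p) := by
  have htarget := e.extend_target_mem_nhdsWithin (I := halfPlaneModel) hp
  rw [range_halfPlaneModel] at htarget ⊢
  obtain ⟨r, hr, hball⟩ := Metric.mem_nhdsWithin_iff.1 htarget
  refine ⟨Metric.ball (e.extend halfPlaneModel p) r ∩ {z | 0 < z.im},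
    Metric.isOpen_ball.inter (isOpen_lt continuous_const Complex.continuous_im),
    ((convex_ball _ _).inter (convex_halfSpace_im_gt 0)).isPreconnected,
    fun z hz => hball ⟨hz.1, show 0 ≤ z.im from le_of_lt hz.2⟩, ?_⟩
  rw [← Complex.closure_setOfPred_lt_im]
  exact Filter.mem_of_superset (Metric.mem_nhdsWithin_iff.2 ⟨r, hr, subset_rfl⟩)
    Metric.isOpen_ball.inter_closure

theorem extend_symm_mem_source (ht : Ω ⊆ (e.extend halfPlaneModel).target) (hz : z ∈ Ω) :
    (e.extend halfPlaneModel).symm z ∈ e.source :=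
  e.extend_source (I := halfPlaneModel) ▸ (e.extend halfPlaneModel).map_target (ht hz)

section CoordDeriv

variable (hop : IsOpen Ω) (ht : Ω ⊆ (e.extend halfPlaneModel).target)
include hop ht

theorem coordDeriv_extend_symm {G : ℂ → F}
    (hg : ∀ w ∈ Ω, g ((e.extend halfPlaneModel).symm w) = G w) (hz : z ∈ Ω) (v : ℂ) :
    coordDeriv e g v ((e.extend halfPlaneModel).symm z) = dirDeriv v G z := by
  have hnhds : {z : ℂ | 0 ≤ z.im} ∈ 𝓝 z := by
    rw [← range_halfPlaneModel]
    exact Filter.mem_of_superset (hop.mem_nhds hz) (ht.trans e.extend_target_subset_range)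
  rw [coordDeriv, (e.extend halfPlaneModel).right_inv (ht hz), fderivWithin_of_mem_nhds hnhds]
  exact dirDeriv_congr hop hg hz

theorem coordDeriv_extend_symm_self (hz : z ∈ Ω) (v : ℂ) :
    coordDeriv e g v ((e.extend halfPlaneModel).symm z) =
      dirDeriv v (g ∘ (e.extend halfPlaneModel).symm) z :=
  coordDeriv_extend_symm hop ht (fun _ _ => rfl) hz v

theorem normalPart_tangentProj_extend_symm (hz : z ∈ Ω) (X : FlatAmbient n) :
    normalPart c u e ((e.extend halfPlaneModel).symm z)
      (tangentProj c (u ((e.extend halfPlaneModel).symm z)) X) =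
      patchNormal c (u ∘ (e.extend halfPlaneModel).symm) z X := by
  rw [normalPart, coordDeriv_extend_symm_self hop ht hz, coordDeriv_extend_symm_self hop ht hz]
  rfl

theorem normalCovDeriv_extend_symm {ξ : S → FlatAmbient n} {X : ℂ → FlatAmbient n}
    (hξ : ∀ w ∈ Ω, ξ ((e.extend halfPlaneModel).symm w) = X w) (hz : z ∈ Ω) (v : ℂ) :
    normalCovDeriv c u e v ξ ((e.extend halfPlaneModel).symm z) =
      patchNormalDeriv c (u ∘ (e.extend halfPlaneModel).symm) v X z := by
  rw [normalCovDeriv, ambientCovDeriv, normalPart_tangentProj_extend_symm hop ht hz,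
    coordDeriv_extend_symm hop ht hξ hz, patchNormalDeriv]

theorem secondFundForm_extend_symm (hz : z ∈ Ω) (v w : ℂ) :
    secondFundForm c u e v w ((e.extend halfPlaneModel).symm z) =
      patchSecondForm c (u ∘ (e.extend halfPlaneModel).symm) v w z :=
  normalCovDeriv_extend_symm hop ht
    (fun _ hx => coordDeriv_extend_symm_self hop ht hx w) hz v

theorem meanCurvature_extend_symm
    (hconf : IsConformalPatch c (u ∘ (e.extend halfPlaneModel).symm) Ω) (hz : z ∈ Ω) :
    meanCurvature c u e ((e.extend halfPlaneModel).symm z) =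
      patchMeanCurvature c (u ∘ (e.extend halfPlaneModel).symm) z := by
  rw [meanCurvature, secondFundForm_extend_symm hop ht hz, secondFundForm_extend_symm hop ht hz,
    coordDeriv_extend_symm_self hop ht hz, coordDeriv_extend_symm_self hop ht hz,
    ← hconf.norm_eq z hz, ← smul_add, smul_smul, one_div, ← mul_inv, patchMeanCurvature,
    confFactor]

end CoordDeriv

variable [ChartedSpace ClosedHalfPlane S]

theorem SmoothOnSurface.contDiffOn (hg : SmoothOnSurface g Set.univ)
    (he : e ∈ atlas ClosedHalfPlane S) :
    ContDiffOn ℝ ∞ (g ∘ (e.extend halfPlaneModel).symm) (e.extend halfPlaneModel).target := by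
  simpa only [Set.preimage_univ, Set.inter_univ] using hg e he

theorem SmoothOnSurface.differentiableWithinAt (hg : SmoothOnSurface g Set.univ)
    (he : e ∈ atlas ClosedHalfPlane S) (hp : p ∈ e.source) :
    DifferentiableWithinAt ℝ (g ∘ (e.extend halfPlaneModel).symm) {z : ℂ | 0 ≤ z.im}
      (e.extend halfPlaneModel p) := by
  refine ((hg.contDiffOn he).differentiableOn (by simp) _
    ((e.extend halfPlaneModel).map_source (by rwa [e.extend_source]))).mono_of_mem_nhdsWithin ?_
  rw [← range_halfPlaneModel]
  exact e.extend_target_mem_nhdsWithin hp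

theorem SmoothOnSurface.continuous (hg : SmoothOnSurface g Set.univ) : Continuous g := by
  refine continuous_iff_continuousAt.2 fun p => ?_
  have hcomp : ContinuousOn g (extChartAt halfPlaneModel p).source :=
    ((hg.contDiffOn (chart_mem_atlas ClosedHalfPlane p)).continuousOn.comp
      (continuousOn_extChartAt p) (extChartAt halfPlaneModel p).mapsTo).congr fun q hq =>
        congrArg g ((extChartAt halfPlaneModel p).left_inv hq).symm
  exact hcomp.continuousAt (extChartAt_source_mem_nhds p)

variable [IsManifold halfPlaneModel ∞ S]

theorem exists_coordDeriv_eq_coordDeriv (hg : SmoothOnSurface g Set.univ)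
    (he : e ∈ atlas ClosedHalfPlane S) (he' : e' ∈ atlas ClosedHalfPlane S)
    (hp : p ∈ e.source) (hp' : p ∈ e'.source) :
    ∃ τ : ℂ →L[ℝ] ℂ, ∀ v, coordDeriv e' g v p = coordDeriv e g (τ v) p := by
  set φ := e.extend halfPlaneModel
  set φ' := e'.extend halfPlaneModel
  have hleft : φ'.symm (φ' p) = p := e'.extend_left_inv hp'
  have hmem : φ' p ∈ {z : ℂ | 0 ≤ z.im} := range_halfPlaneModel ▸ Set.mem_range_self _
  have hmaps : Set.MapsTo (φ ∘ φ'.symm) {z : ℂ | 0 ≤ z.im} {z : ℂ | 0 ≤ z.im} :=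
    fun w _ => range_halfPlaneModel ▸ Set.mem_range_self _
  have hτ : DifferentiableWithinAt ℝ (φ ∘ φ'.symm) {z : ℂ | 0 ≤ z.im} (φ' p) := by
    rw [← range_halfPlaneModel]
    exact ((halfPlaneModel.contDiffWithinAt_extendCoordChange' (n := ∞)
      (IsManifold.subset_maximalAtlas he') (IsManifold.subset_maximalAtlas he) hp'
      hp).restrict_scalars ℝ).differentiableWithinAt (by simp)
  have hev : g ∘ φ'.symm =ᶠ[𝓝[{z : ℂ | 0 ≤ z.im}] (φ' p)] (g ∘ φ.symm) ∘ (φ ∘ φ'.symm) := by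
    rw [← range_halfPlaneModel]
    filter_upwards [halfPlaneModel.extendCoordChange_source_mem_nhdsWithin' hp' hp] with w hw
    exact congrArg g (φ.left_inv hw.2).symm
  refine ⟨fderivWithin ℝ (φ ∘ φ'.symm) {z : ℂ | 0 ≤ z.im} (φ' p), fun v => ?_⟩
  rw [coordDeriv, hev.fderivWithin_eq (hev.self_of_nhdsWithin hmem),
    fderivWithin_comp (φ' p) (t := {z : ℂ | 0 ≤ z.im}) ?_ hτ hmaps
      (uniqueDiffOn_closedHalfPlane _ hmem), Function.comp_apply, hleft]
  · rfl
  · rw [Function.comp_apply, hleft]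
    exact hg.differentiableWithinAt he hp

theorem mem_branchSet_iff_coordDeriv (hu : SmoothOnSurface u Set.univ)
    (he : e ∈ atlas ClosedHalfPlane S) (hp : p ∈ e.source) :
    p ∈ branchSet u ↔ ∀ v, coordDeriv e u v p = 0 := by
  obtain ⟨τ, hτ⟩ := exists_coordDeriv_eq_coordDeriv hu (chart_mem_atlas _ p) he
    (mem_chart_source _ p) hp
  obtain ⟨τ', hτ'⟩ := exists_coordDeriv_eq_coordDeriv hu he (chart_mem_atlas _ p) hp
    (mem_chart_source _ p)
  exact ⟨fun h v => (hτ v).trans (h _), fun h v => (hτ' v).trans (h _)⟩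

theorem smoothOnSurface_comp_extend (he : e ∈ atlas ClosedHalfPlane S) {ξ : ℂ → F}
    (hξ : ContDiffOn ℝ ∞ ξ Ω) :
    SmoothOnSurface (ξ ∘ e.extend halfPlaneModel)
      (e.source ∩ e.extend halfPlaneModel ⁻¹' Ω) := by
  intro e' he'
  have hτ := (halfPlaneModel.contDiffOn_extendCoordChange (n := ∞)
    (IsManifold.subset_maximalAtlas he') (IsManifold.subset_maximalAtlas he)).restrict_scalars ℝ
  refine hξ.comp (hτ.mono ?_) fun w hw => hw.2.2
  rintro w ⟨hw, hwe, -⟩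
  exact ⟨hw, by rwa [Set.mem_preimage, e.extend_source]⟩

section Patches

variable (hop : IsOpen Ω) (ht : Ω ⊆ (e.extend halfPlaneModel).target)
  (he : e ∈ atlas ClosedHalfPlane S) (hu : IsBranchedImmersion c u)
include hop ht he hu

theorem confFactor_extend_symm_eq_zero_iff (hz : z ∈ Ω) :
    confFactor c (u ∘ (e.extend halfPlaneModel).symm) z = 0 ↔
      (e.extend halfPlaneModel).symm z ∈ branchSet u := by
  have hp := extend_symm_mem_source ht hz
  have htan := isTangentAt_dirDeriv hop ((hu.smooth.contDiffOn he).mono ht)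
    (fun w _ => hu.mem ((e.extend halfPlaneModel).symm w)) hz
  have hnorm := hu.conformal_norm e he _ hp
  simp only [coordDeriv_extend_symm_self hop ht hz] at hnorm
  simp only [mem_branchSet_iff_coordDeriv hu.smooth he hp, coordDeriv_extend_symm_self hop ht hz]
  refine ⟨fun h0 v => ?_, fun h => by rw [confFactor, h, ambForm_zero_right]⟩
  have hfst := (ambForm_self_eq_zero_iff_of_isTangentAt (hu.mem _) (htan 1)).1 h0
  have hsnd := (ambForm_self_eq_zero_iff_of_isTangentAt (hu.mem _) (htan Complex.I)).1
    (hnorm.symm.trans h0)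
  rw [dirDeriv_eq_re_smul_add_im_smul, hfst, hsnd, smul_zero, smul_zero, add_zero]

theorem isOpen_diff_preimage_branchSet :
    IsOpen (Ω \ (e.extend halfPlaneModel).symm ⁻¹' branchSet u) := by
  have hsmooth := (hu.smooth.contDiffOn he).mono ht
  have hconf : ContinuousOn (confFactor c (u ∘ (e.extend halfPlaneModel).symm)) Ω :=
    (contDiffOn_ambForm (contDiffOn_dirDeriv hop hsmooth 1)
      (contDiffOn_dirDeriv hop hsmooth 1)).continuousOn
  have hset : Ω \ (e.extend halfPlaneModel).symm ⁻¹' branchSet u =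
      Ω ∩ confFactor c (u ∘ (e.extend halfPlaneModel).symm) ⁻¹' {0}ᶜ :=
    Set.ext fun z => and_congr_right fun hz =>
      not_congr (confFactor_extend_symm_eq_zero_iff hop ht he hu hz).symm
  exact hset ▸ hconf.isOpen_inter_preimage hop isOpen_compl_singleton

variable (hb : ∀ z ∈ Ω, (e.extend halfPlaneModel).symm z ∉ branchSet u)
include hb

theorem isConformalPatch_extend_symm :
    IsConformalPatch c (u ∘ (e.extend halfPlaneModel).symm) Ω where
  isOpen := hop
  smooth := (hu.smooth.contDiffOn he).mono ht
  mem _ _ := hu.mem _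
  norm_eq z hz := by
    simpa only [coordDeriv_extend_symm_self hop ht hz] using
      hu.conformal_norm e he _ (extend_symm_mem_source ht hz)
  orth z hz := by
    simpa only [coordDeriv_extend_symm_self hop ht hz] using
      hu.conformal_orthogonal e he _ (extend_symm_mem_source ht hz)
  norm_ne z hz := mt (confFactor_extend_symm_eq_zero_iff hop ht he hu hz).1 (hb z hz)

omit hu hb in
theorem isNormalSection_comp_extend {ξ : ℂ → FlatAmbient n}
    (hξ : IsPatchNormalField c (u ∘ (e.extend halfPlaneModel).symm) Ω ξ) :
    IsNormalSection c u e (e.source ∩ e.extend halfPlaneModel ⁻¹' Ω)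
      (ξ ∘ e.extend halfPlaneModel) where
  smooth := smoothOnSurface_comp_extend he hξ.smooth
  tangent q hq := by
    simpa only [Function.comp_apply, e.extend_left_inv hq.1] using (hξ.normal _ hq.2).tangent
  normal q hq v := by
    have hcoord := coordDeriv_extend_symm_self (g := u) hop ht hq.2 v
    rw [e.extend_left_inv hq.1] at hcoord
    rw [hcoord]
    exact hξ.ambForm_dirDeriv_eq_zero hq.2 v

theorem isParallelFlatPatch_extend_symm (hparallel : HasParallelMeanCurvature c u)
    (hflat : HasFlatNormalBundle c u) :
    IsParallelFlatPatch c (u ∘ (e.extend halfPlaneModel).symm) Ω where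
  __ := isConformalPatch_extend_symm hop ht he hu hb
  parallel z hz v := by
    rw [← normalCovDeriv_extend_symm hop ht (fun w hw => meanCurvature_extend_symm hop ht
      (isConformalPatch_extend_symm hop ht he hu hb) hw) hz v]
    exact hparallel e he _ (extend_symm_mem_source ht hz) (hb z hz) v
  flat ξ hξ z hz := by
    have hext : ∀ w ∈ Ω, (ξ ∘ e.extend halfPlaneModel) ((e.extend halfPlaneModel).symm w) = ξ w :=
      fun w hw => congrArg ξ ((e.extend halfPlaneModel).right_inv (ht hw))
    have hsub : e.source ∩ e.extend halfPlaneModel ⁻¹' Ω ⊆ e.source \ branchSet u :=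
      fun q hq => ⟨hq.1, e.extend_left_inv (I := halfPlaneModel) hq.1 ▸ hb _ hq.2⟩
    have hmem : (e.extend halfPlaneModel).symm z ∈ e.source ∩ e.extend halfPlaneModel ⁻¹' Ω :=
      ⟨extend_symm_mem_source ht hz,
        by rwa [Set.mem_preimage, (e.extend halfPlaneModel).right_inv (ht hz)]⟩
    have hcurv := hflat e he _ (e.isOpen_extend_preimage hop) hsub _
      (isNormalSection_comp_extend hop ht he hξ) _ hmem 1 Complex.I
    have hderiv (v : ℂ) : ∀ w ∈ Ω, _ :=
      fun w hw => normalCovDeriv_extend_symm (u := u) (c := c) hop ht hext hw v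
    rw [normalCurvature, normalCovDeriv_extend_symm hop ht (hderiv _) hz,
      normalCovDeriv_extend_symm hop ht (hderiv _) hz] at hcurv
    exact sub_eq_zero.1 hcurv

end Patches

end Charts

section SurfacePatch

variable {S : Type*} [TopologicalSpace S] {n : ℕ}

/-- A connected plane domain `Ω`, mapped by `ψ` to an open set of the surface, on which `u ∘ ψ`
is a parallel flat patch. -/
structure IsSurfacePatch (c : ℝ) (u : S → FlatAmbient n) (ψ : ℂ → S) (Ω : Set ℂ) : Prop where
  isPreconnected : IsPreconnected Ω
  isParallelFlatPatch : IsParallelFlatPatch c (u ∘ ψ) Ω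
  continuousOn : ContinuousOn ψ Ω
  isOpen_image : IsOpen (ψ '' Ω)

variable {c : ℝ} {u : S → FlatAmbient n} {ψ : ℂ → S} {Ω : Set ℂ} {W : Submodule ℝ (FlatAmbient n)}

theorem IsSurfacePatch.image_subset_of_inter_interior_nonempty (h : IsSurfacePatch c u ψ Ω)
    (hW : (ψ '' Ω ∩ interior (u ⁻¹' W)).Nonempty) : ψ '' Ω ⊆ u ⁻¹' W := by
  obtain ⟨_, ⟨z, hz, rfl⟩, hzW⟩ := hW
  rintro _ ⟨w, hw, rfl⟩
  exact h.isParallelFlatPatch.mem_submodule_of_open_subset h.isPreconnected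
    (h.continuousOn.isOpen_inter_preimage h.isParallelFlatPatch.isOpen isOpen_interior)
    ⟨z, hz, hzW⟩ Set.inter_subset_left
    (fun x hx => interior_subset (s := u ⁻¹' W) hx.2) hw

variable [ChartedSpace ClosedHalfPlane S] [IsManifold halfPlaneModel ∞ S]

theorem exists_isSurfacePatch_closure_mem_nhds (hu : IsBranchedImmersion c u)
    (hparallel : HasParallelMeanCurvature c u) (hflat : HasFlatNormalBundle c u) (p : S) :
    ∃ ψ Ω, IsSurfacePatch c u ψ Ω ∧ closure (ψ '' Ω) ∈ 𝓝 p := by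
  have hp := mem_chart_source ClosedHalfPlane p
  have he := chart_mem_atlas ClosedHalfPlane p
  set e := chartAt ClosedHalfPlane p
  set φ := e.extend halfPlaneModel
  obtain ⟨Ω, hop, hΩ, ht, hclosure⟩ := exists_isPreconnected_subset_extend_target hp
  have hcountable : (Ω ∩ φ.symm ⁻¹' branchSet u).Countable :=
    countable_inter_preimage_of_isDiscrete (e.continuousOn_extend_symm.mono ht)
      (φ.symm.injOn.mono ht) hu.discrete_branchSet
  have hopen : IsOpen (Ω \ φ.symm ⁻¹' branchSet u) := isOpen_diff_preimage_branchSet hop ht he hu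
  have ht' : Ω \ φ.symm ⁻¹' branchSet u ⊆ φ.target := Set.sdiff_subset.trans ht
  refine ⟨φ.symm, Ω \ φ.symm ⁻¹' branchSet u, ⟨?_,
    isParallelFlatPatch_extend_symm hopen ht' he hu (fun z hz => hz.2) hparallel hflat,
    e.continuousOn_extend_symm.mono ht', isOpen_image_extend_symm hopen ht'⟩,
    closure_image_extend_symm_mem_nhds hp (Filter.mem_of_superset hclosure ?_)⟩
  all_goals rw [← Set.sdiff_self_inter]
  · exact isPreconnected_diff_countable (by rw [Complex.rank_real_complex]; norm_num) hop hΩ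
      hcountable
  · exact closure_minimal ((hcountable.dense_compl ℝ).open_subset_closure_inter hop)
      isClosed_closure

end SurfacePatch

theorem exists_submodule_finrank_le_five_range_subset {S : Type*} [TopologicalSpace S]
    [ConnectedSpace S] [ChartedSpace ClosedHalfPlane S] [IsManifold halfPlaneModel ∞ S] {n : ℕ}
    {c : ℝ} {u : S → FlatAmbient n} (hu : IsBranchedImmersion c u)
    (hparallel : HasParallelMeanCurvature c u) (hflat : HasFlatNormalBundle c u) :
    ∃ W : Submodule ℝ (FlatAmbient n), Module.finrank ℝ W ≤ 5 ∧ Set.range u ⊆ W := by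
  obtain ⟨p⟩ : Nonempty S := inferInstance
  have hpatch := exists_isSurfacePatch_closure_mem_nhds hu hparallel hflat
  obtain ⟨ψ, Ω, hψ, hclosure⟩ := hpatch p
  have hne : (ψ '' Ω).Nonempty := closure_nonempty_iff.1 ⟨p, mem_of_mem_nhds hclosure⟩
  obtain ⟨W, hWdim, hW⟩ := hψ.isParallelFlatPatch.exists_submodule_finrank_le_five
    hψ.isPreconnected (Set.image_nonempty.1 hne)
  have hclosed : IsClosed (u ⁻¹' W) := W.closed_of_finiteDimensional.preimage hu.smooth.continuous
  have hinterior : (interior (u ⁻¹' W)).Nonempty :=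
    hne.mono (interior_maximal (Set.image_subset_iff.2 hW) hψ.isOpen_image)
  have huniv := eq_univ_of_isClosed_of_subset_of_inter_interior_nonempty hclosed hinterior fun q =>
    let ⟨_, _, hψ', hq⟩ := hpatch q
    ⟨_, hq, hψ'.image_subset_of_inter_interior_nonempty⟩
  exact ⟨W, hWdim, Set.range_subset_iff.2 (Set.eq_univ_iff_forall.1 huniv)⟩

theorem mainTheorem4_general {S : Type*} [TopologicalSpace S] [ConnectedSpace S]
    [ChartedSpace ClosedHalfPlane S] [IsManifold halfPlaneModel ∞ S]
    (n : ℕ) (hn : 4 ≤ n) (c : ℝ) (u : S → FlatAmbient n)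
    (hu : IsBranchedImmersion c u)
    (hparallel : HasParallelMeanCurvature c u)
    (hflat : HasFlatNormalBundle c u) :
    ∃ P : Set (FlatAmbient n), IsTotallyGeodesicSpaceForm 4 n c P ∧ Set.range u ⊆ P := by
  obtain ⟨p⟩ : Nonempty S := inferInstance
  obtain ⟨W, hWdim, hW⟩ := exists_submodule_finrank_le_five_range_subset hu hparallel hflat
  obtain ⟨P, hP, hWP⟩ := exists_isTotallyGeodesicSpaceForm_of_finrank_le (hu.mem p)
    (hW (Set.mem_range_self p)) hn hWdim
  exact ⟨P, hP, (Set.subset_inter (Set.range_subset_iff.2 hu.mem) hW).trans hWP⟩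

theorem mainTheorem4 {S : Type*} [TopologicalSpace S] [T2Space S] [ConnectedSpace S]
    [ChartedSpace ClosedHalfPlane S] [IsManifold halfPlaneModel ∞ S]
    (n : ℕ) (hn : 4 ≤ n) (c : ℝ) (u : S → FlatAmbient n)
    (hu : IsBranchedImmersion c u)
    (hparallel : HasParallelMeanCurvature c u)
    (hnonzero : ¬ MeanCurvatureVanishes c u)
    (hflat : HasFlatNormalBundle c u) :
    ∃ P : Set (FlatAmbient n), IsTotallyGeodesicSpaceForm 4 n c P ∧ Set.range u ⊆ P :=
  mainTheorem4_general n hn c u hu hparallel hflat
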